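/- Let $v=(v_1,v_2)^\top$ with $v_1,v_2\in L^2(\mathbb T)$ complex-valued, $\mathbb T=\mathbb R/\mathbb Z$, regarded as $1$-periodic functions on $\mathbb R$. Put $$J=\begin{pmatrix}1&0\\0&-\mathbb 1_2\end{pmatrix},\qquad V=\begin{pmatrix}0&v^*\\ v&0\end{pmatrix},$$ and let $\mathcal L=iJ\frac{d}{dx}+V$ be the operator in $L^2(\mathbb R,\mathbb C^3)$ with domain $\{u\in L^2(\mathbb R,\mathbb C^3): u \text{ locally absolutely continuous},\ iJu'+Vu\in L^2(\mathbb R,\mathbb C^3)\}$. For every $\lambda\in\mathbb C$ there is a unique locally absolutely continuous $3\times3$ matrix-valued solution $y(x,\lambda)$, $x\in\mathbb R$, of $iJy'+Vy=\lambda y$ (a.e.), $y(0,\lambda)=\mathbb 1_3$. Let $\psi(\lambda)=y(1,\lambda)$, $D(\tau,\lambda)=\det(\psi(\lambda)-\tau\mathbb 1_3)$, $T(\lambda)=\operatorname{Tr}\psi(\lambda)$, $\widetilde T(\lambda)=\overline{T(\overline\lambda)}$, and let the multipliers $\tau_1(\lambda),\tau_2(\lambda),\tau_3(\lambda)$ be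 the eigenvalues of $\psi(\lambda)$ counted with algebraic multiplicity. Put $\tau_1^o(\lambda)=\tau_2^o(\lambda)=e^{i\lambda}$ and $\tau_3^o(\lambda)=e^{-i\lambda}$ (the multipliers for $v=0$). For $k\in\{1,2,3\}$ let $\mathfrak S_k$ be the set of $\lambda\in\mathbb R$ such that $|\tau_j(\lambda)|=1$ for exactly $k$ of the indices $j\in\{1,2,3\}$. Then: (i) The multipliers can be labelled, for each $\lambda\in\mathbb C$, so that for every $\delta\in(0,\tfrac12)$ and every $j\in\{1,2,3\}$ $$\tau_j(\lambda)=\tau_j^o(\lambda)\,(1+o(1))\quad\text{as } |\lambda|\to\infty,\ \ |\lambda-\pi n|\ge\delta\ \text{ for all } n\in\mathbb Z .$$ For all $\tau,\lambda\in\mathbb C$, $$D(\tau,\lambda)=-\tau^3+\tau^2T(\lambda)-\tau e^{i\lambda}\widetilde T(\lambda)+e^{i\lambda},$$ and, for all $\lambda\in\mathbb C$ and any labelling of the multipliers, $$\det\psi(\lambda)=e^{i\lambda}=\tau_1\tau_2\tau_3,\qquad \widetilde T(\lambda)=\frac1{\tau_1}+\frac1{\tau_2}+\frac1{\tau_3}=e^{-i\lambda}(\tau_1\tau_2+\tau_2\tau_3+\tau_3\tau_1).$$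 (ii) The spectrum of $\mathcal L$ is $\sigma(\mathcal L)=\mathbb R=\mathfrak S_1\cup\mathfrak S_3$, and $\mathfrak S_2=\emptyset$. -/

import Mathlib

open MeasureTheory Filter Topology Asymptotics

namespace Manakov

noncomputable section

/-- The space `ℂ³` with its Euclidean norm. -/
abbrev C3 : Type := EuclideanSpace ℂ (Fin 3)

/-- The Hilbert space `L²(ℝ, ℂ³)`. -/
abbrev L2 : Type := Lp C3 2 (volume : Measure ℝ)

/-- `v = (v₁, v₂)` is 1-periodic and belongs to `L²(𝕋) ⊕ L²(𝕋)`, `𝕋 = ℝ/ℤ`. -/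
structure IsPotential (v : Fin 2 → ℝ → ℂ) : Prop where
  periodic : ∀ i, Function.Periodic (v i) 1
  memLp : ∀ i, MemLp (v i) 2 (volume.restrict (Set.Ioc (0 : ℝ) 1))

/-- The matrix `J = diag(1, -1, -1)`. -/
def J : Matrix (Fin 3) (Fin 3) ℂ := !![1, 0, 0; 0, -1, 0; 0, 0, -1]

/-- The matrix potential `V = [[0, v*], [v, 0]]`, where `v` is a column. -/
def V (v : Fin 2 → ℝ → ℂ) (x : ℝ) : Matrix (Fin 3) (Fin 3) ℂ :=
  !![0, star (v 0 x), star (v 1 x);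
     v 0 x, 0, 0;
     v 1 x, 0, 0]

/-- The value `i J p + V(x) w`; with `w = u(x)` and `p = u'(x)` this is `(iJu' + Vu)(x)`. -/
def expr (v : Fin 2 → ℝ → ℂ) (x : ℝ) (w p : C3) : C3 :=
  WithLp.toLp 2 (Complex.I • (J.mulVec p.ofLp) + (V v x).mulVec w.ofLp)

/-- `u` is locally absolutely continuous on `ℝ` and `iJu' + Vu = g` almost everywhere. -/
def Solves (v : Fin 2 → ℝ → ℂ) (u g : ℝ → C3) : Prop :=
  (∀ a b : ℝ, AbsolutelyContinuousOnInterval u a b) ∧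
    ∀ᵐ x : ℝ, ∃ p : C3, HasDerivAt u p x ∧ expr v x (u x) p = g x

/-- The `j`-th column of a matrix valued function. -/
def column (y : ℝ → Matrix (Fin 3) (Fin 3) ℂ) (j : Fin 3) (x : ℝ) : C3 :=
  WithLp.toLp 2 (fun i => y x i j)

/-- `y` is a matrix valued solution of `iJy' + Vy = z y`, `y(0) = 1`. -/
def IsFundamentalSolution (v : Fin 2 → ℝ → ℂ) (z : ℂ)
    (y : ℝ → Matrix (Fin 3) (Fin 3) ℂ) : Prop :=
  y 0 = 1 ∧ ∀ j, Solves v (column y j) (fun x => z • column y j x)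

/-- The fundamental solution `y(x, z)`. That it exists and is unique for every potential
is part of the main statement. -/
def fundamentalSolution (v : Fin 2 → ℝ → ℂ) (z : ℂ) : ℝ → Matrix (Fin 3) (Fin 3) ℂ :=
  Classical.epsilon (IsFundamentalSolution v z)

/-- The monodromy matrix `ψ(z) = y(1, z)`. -/
def monodromy (v : Fin 2 → ℝ → ℂ) (z : ℂ) : Matrix (Fin 3) (Fin 3) ℂ :=
  fundamentalSolution v z 1

/-- `D(τ, z) = det(ψ(z) - τ)`. -/
def D (v : Fin 2 → ℝ → ℂ) (τ z : ℂ) : ℂ := (monodromy v z - τ • 1).det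

/-- `T(z) = Tr ψ(z)`. -/
def T (v : Fin 2 → ℝ → ℂ) (z : ℂ) : ℂ := (monodromy v z).trace

/-- `T̃(z)`, the conjugate of `T` at the conjugate of `z`. -/
def Ttilde (v : Fin 2 → ℝ → ℂ) (z : ℂ) : ℂ := star (T v (star z))

/-- The multipliers: the eigenvalues of `ψ(z)`, repeated according to algebraic multiplicity. -/
def multipliers (v : Fin 2 → ℝ → ℂ) (z : ℂ) : Multiset ℂ := (monodromy v z).charpoly.roots

/-- The multipliers for `v = 0`, labelled as `e^{iz}, e^{iz}, e^{-iz}`. -/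
def freeMultiplier (j : Fin 3) (z : ℂ) : ℂ :=
  ![Complex.exp (Complex.I * z), Complex.exp (Complex.I * z), Complex.exp (-Complex.I * z)] j

/-- `|z| → ∞` with `|z - πn| ≥ δ` for all integers `n`. -/
def awayFilter (δ : ℝ) : Filter ℂ :=
  Bornology.cobounded ℂ ⊓ 𝓟 {z : ℂ | ∀ n : ℤ, δ ≤ ‖z - (Real.pi : ℂ) * (n : ℂ)‖}

open Classical in
/-- `𝔖ₖ`: the real `t` for which exactly `k` multipliers, counted with multiplicity,
have modulus one. -/
def spectralPart (v : Fin 2 → ℝ → ℂ) (k : ℕ) : Set ℝ :=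
  {t : ℝ | (multipliers v (t : ℂ)).countP (fun τ => ‖τ‖ = 1) = k}

lemma expr_zero (v : Fin 2 → ℝ → ℂ) (x : ℝ) : expr v x 0 0 = 0 := by
  simp [expr]

lemma expr_add (v : Fin 2 → ℝ → ℂ) (x : ℝ) (w p w' p' : C3) :
    expr v x (w + w') (p + p') = expr v x w p + expr v x w' p' := by
  ext i
  simp only [expr, WithLp.ofLp_add, Matrix.mulVec_add, smul_add, Pi.add_apply]
  ring

lemma expr_smul (v : Fin 2 → ℝ → ℂ) (x : ℝ) (c : ℂ) (w p : C3) :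
    expr v x (c • w) (c • p) = c • expr v x w p := by
  ext i
  simp only [expr, WithLp.ofLp_smul, Matrix.mulVec_smul, Pi.add_apply, Pi.smul_apply, smul_eq_mul]
  ring

/-- The graph of `𝓛 = iJ d/dx + V` in `L²(ℝ, ℂ³)` on its maximal domain: all `f ∈ L²` with a
locally absolutely continuous representative `u` such that `iJu' + Vu ∈ L²`. -/
def graph (v : Fin 2 → ℝ → ℂ) : Submodule ℂ (L2 × L2) where
  carrier := {q | ∃ u : ℝ → C3, q.1 =ᵐ[volume] u ∧ Solves v u q.2}
  zero_mem' := by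
    refine ⟨fun _ => 0, Lp.coeFn_zero _ _ _, ?_, ?_⟩
    · intro a b
      exact (LipschitzWith.const (0 : C3)).lipschitzOnWith.absolutelyContinuousOnInterval
    · filter_upwards [Lp.coeFn_zero C3 2 (volume : Measure ℝ)] with x hx
      exact ⟨0, hasDerivAt_const x 0, by rw [expr_zero]; exact hx.symm⟩
  add_mem' := by
    rintro ⟨f, g⟩ ⟨f', g'⟩ ⟨u, hf, hu, hg⟩ ⟨u', hf', hu', hg'⟩
    refine ⟨fun x => u x + u' x, ?_, fun a b => (hu a b).add (hu' a b), ?_⟩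
    · filter_upwards [Lp.coeFn_add f f', hf, hf'] with x h1 h2 h3
      simpa [h2, h3] using h1
    · filter_upwards [Lp.coeFn_add g g', hg, hg'] with x h1 h2 h3
      obtain ⟨p, hp, hpe⟩ := h2
      obtain ⟨p', hp', hpe'⟩ := h3
      refine ⟨p + p', hp.add hp', ?_⟩
      rw [expr_add, hpe, hpe']
      exact h1.symm
  smul_mem' := by
    rintro c ⟨f, g⟩ ⟨u, hf, hu, hg⟩
    refine ⟨fun x => c • u x, ?_, fun a b => (hu a b).const_smul c, ?_⟩
    · filter_upwards [Lp.coeFn_smul c f, hf] with x h1 h2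
      simpa [h2] using h1
    · filter_upwards [Lp.coeFn_smul c g, hg] with x h1 h2
      obtain ⟨p, hp, hpe⟩ := h2
      refine ⟨c • p, hp.const_smul c, ?_⟩
      rw [expr_smul, hpe]
      exact h1.symm

/-- The graph is single valued. -/
lemma graph_single_valued (v : Fin 2 → ℝ → ℂ) (q : L2 × L2) (hq : q ∈ graph v)
    (h0 : q.1 = 0) : q.2 = 0 := by
  obtain ⟨u, hf, hu, hg⟩ := hq
  have hc : Continuous u := by
    rw [continuous_iff_continuousAt]
    intro x
    have h := (hu (x - 1) (x + 1)).continuousOn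
    rw [Set.uIcc_of_le (by linarith)] at h
    exact h.continuousAt (Icc_mem_nhds (by linarith) (by linarith))
  have hu0 : u = fun _ => 0 := by
    refine (hc.ae_eq_iff_eq volume continuous_const).1 ?_
    rw [h0] at hf
    exact hf.symm.trans (Lp.coeFn_zero _ _ _)
  refine (Lp.eq_zero_iff_ae_eq_zero).2 ?_
  filter_upwards [hg] with x hx
  obtain ⟨p, hp, hpe⟩ := hx
  rw [hu0] at hp hpe
  have hp0 : p = 0 := hp.unique (hasDerivAt_const x 0)
  rw [← hpe, hp0]
  exact expr_zero v x

/-- The Manakov operator `𝓛 = iJ d/dx + V` in `L²(ℝ, ℂ³)`, an unbounded operator. -/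
def operator (v : Fin 2 → ℝ → ℂ) : L2 →ₗ.[ℂ] L2 := (graph v).toLinearPMap

lemma operator_graph (v : Fin 2 → ℝ → ℂ) : (operator v).graph = graph v :=
  (graph v).toLinearPMap_graph_eq (graph_single_valued v)

/-- `z` is in the resolvent set of the unbounded operator `A`: `A - z` maps the domain of `A`
bijectively onto the whole space and its inverse is bounded. -/
def IsResolventPoint {E : Type*} [NormedAddCommGroup E] [NormedSpace ℂ E]
    (A : E →ₗ.[ℂ] E) (z : ℂ) : Prop :=
  ∃ R : E →L[ℂ] E,
    (∀ g : E, ∃ h : R g ∈ A.domain, A ⟨R g, h⟩ - z • R g = g) ∧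
    ∀ f : A.domain, R (A f - z • (f : E)) = f

/-- The spectrum of an unbounded operator, the complement of its resolvent set. -/
def spectrumOf {E : Type*} [NormedAddCommGroup E] [NormedSpace ℂ E]
    (A : E →ₗ.[ℂ] E) : Set ℂ :=
  {z | ¬ IsResolventPoint A z}

end

end Manakov

/-! Everything rests on the Lagrange identity (`hasACDeriv_form`): for the indefinite form `w* J u`,
the derivative along two solutions is `i(⟨h, u⟩ - ⟨w, g⟩)`, because `V` is Hermitian.

On one period it gives `ψ(z̄)* J ψ(z) = J`. Liouville's formula gives `det ψ = e^{iz}`. Hence `ψ⁻¹ =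
J ψ(z̄)* J`, so the middle coefficient of the cubic `D` is `e^{iz} T̃`, and all the identities are
Vieta's formulas. For real `z` the roots are symmetric in the unit circle and their product has
modulus one. Three roots with this symmetry have one or three members on the circle, never zero or
two.

For the asymptotics, eliminating the second and third components turns the first one into a Volterra
equation whose kernel is an oscillatory integral of `v`. A Riemann–Lebesgue lemma, uniform in `z`
relative to `e^{|Im z|(x-s)}`, makes this kernel small and yields `T = 2e^{iz} + e^{-iz} + o(e^{|Im
z|})`. After rescaling, the characteristic cubic is close to `(w - 1)²(w - q)` with `q = e^{±2iz}`
and `|q| ≤ 1`. Away from `πℤ` the number `q` keeps a positive distance from `1`, so two roots are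
near `1`, and the determinant determines the third. A labelling that minimises the distance to the
free multipliers serves all `δ` at once.

For the spectrum, the Lagrange identity integrated over the line shows that the operator is
symmetric. A du Bois-Reymond argument shows that every weak solution lies in the graph
(`mem_graph_of_weak`). The operator is therefore self-adjoint, and nonreal points are in the
resolvent set by the usual estimate with `|Im z|`. At a real point at least one multiplier is
unimodular. Its Bloch solution has periodic norm, and cutting it off at scale `n` gives a Weyl
sequence, which excludes a bounded resolvent. -/

namespace Manakov

open scoped ContDiff

/-! ### Locally absolutely continuous functions with a prescribed derivative -/

section Postcomposition

variable {X Y : Type*} [PseudoMetricSpace X] [PseudoMetricSpace Y]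

lemma _root_.AbsolutelyContinuousOnInterval.lipschitz_comp {f : ℝ → X} {φ : X → Y} {K : NNReal}
    {a b : ℝ} (hf : AbsolutelyContinuousOnInterval f a b) (hφ : LipschitzWith K φ) :
    AbsolutelyContinuousOnInterval (fun x => φ (f x)) a b := by
  refine squeeze_zero (fun E => Finset.sum_nonneg fun i _ => dist_nonneg) (fun E => ?_)
    (by simpa using Tendsto.const_mul (K : ℝ) hf)
  rw [Finset.mul_sum]
  exact Finset.sum_le_sum fun i _ => hφ.dist_le_mul _ _

end Postcomposition

/-- `f` is locally absolutely continuous on `ℝ` with almost everywhere derivative `m`. -/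
def HasACDeriv (f m : ℝ → ℂ) : Prop :=
  (∀ a b : ℝ, AbsolutelyContinuousOnInterval f a b) ∧ ∀ᵐ x : ℝ, HasDerivAt f (m x) x

lemma lipschitzWith_re : LipschitzWith 1 Complex.re :=
  LipschitzWith.of_dist_le_mul fun z w => by
    simpa [Complex.dist_eq, Real.dist_eq] using Complex.abs_re_le_norm (z - w)

lemma lipschitzWith_im : LipschitzWith 1 Complex.im :=
  LipschitzWith.of_dist_le_mul fun z w => by
    simpa [Complex.dist_eq, Real.dist_eq] using Complex.abs_im_le_norm (z - w)

lemma lipschitzWith_ofReal : LipschitzWith 1 (fun x : ℝ => (x : ℂ)) :=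
  Complex.isometry_ofReal.lipschitz

lemma lipschitzWith_star : LipschitzWith 1 (Star.star : ℂ → ℂ) :=
  LipschitzWith.of_dist_le_mul fun z w => by
    simp [dist_eq_norm, ← map_sub]

lemma _root_.IntervalIntegrable.complex_ofReal {p : ℝ → ℝ} {a b : ℝ}
    (hp : IntervalIntegrable p volume a b) :
    IntervalIntegrable (fun t => (p t : ℂ)) volume a b :=
  ⟨hp.1.ofReal, hp.2.ofReal⟩

namespace HasACDeriv

variable {f g m n : ℝ → ℂ}

lemma congr (hf : HasACDeriv f m) (h : m =ᵐ[volume] n) : HasACDeriv f n :=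
  ⟨hf.1, by filter_upwards [hf.2, h] with x hx hm; rwa [← hm]⟩

lemma congr_fun (hf : HasACDeriv f m) (h : ∀ x, f x = g x) : HasACDeriv g m := by
  rwa [← funext h]

lemma const (c : ℂ) : HasACDeriv (fun _ => c) (fun _ => 0) :=
  ⟨fun _ _ => (LipschitzWith.const c).lipschitzOnWith.absolutelyContinuousOnInterval,
    Eventually.of_forall fun x => hasDerivAt_const x c⟩

lemma add (hf : HasACDeriv f m) (hg : HasACDeriv g n) :
    HasACDeriv (fun x => f x + g x) (fun x => m x + n x) :=
  ⟨fun a b => (hf.1 a b).add (hg.1 a b), by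
    filter_upwards [hf.2, hg.2] with x h1 h2 using h1.add h2⟩

lemma neg (hf : HasACDeriv f m) : HasACDeriv (fun x => -f x) (fun x => -m x) :=
  ⟨fun a b => (hf.1 a b).neg, by filter_upwards [hf.2] with x h1 using h1.neg⟩

lemma sub (hf : HasACDeriv f m) (hg : HasACDeriv g n) :
    HasACDeriv (fun x => f x - g x) (fun x => m x - n x) :=
  ⟨fun a b => (hf.1 a b).sub (hg.1 a b), by
    filter_upwards [hf.2, hg.2] with x h1 h2 using h1.sub h2⟩

lemma mul (hf : HasACDeriv f m) (hg : HasACDeriv g n) :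
    HasACDeriv (fun x => f x * g x) (fun x => m x * g x + f x * n x) :=
  ⟨fun a b => (hf.1 a b).smul (hg.1 a b), by
    filter_upwards [hf.2, hg.2] with x h1 h2 using h1.mul h2⟩

lemma const_mul (c : ℂ) (hf : HasACDeriv f m) :
    HasACDeriv (fun x => c * f x) (fun x => c * m x) :=
  ⟨fun a b => (hf.1 a b).const_smul c, by filter_upwards [hf.2] with x h1 using h1.const_mul c⟩

lemma star (hf : HasACDeriv f m) :
    HasACDeriv (fun x => Star.star (f x)) (fun x => Star.star (m x)) :=
  ⟨fun a b => (hf.1 a b).lipschitz_comp lipschitzWith_star, by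
    filter_upwards [hf.2] with x h1 using h1.star⟩

lemma of_contDiff (hf : ContDiff ℝ 1 f) : HasACDeriv f (deriv f) :=
  ⟨fun _ _ => hf.contDiffOn.absolutelyContinuousOnInterval, Eventually.of_forall fun x =>
    (hf.differentiable one_ne_zero x).hasDerivAt⟩

lemma exp (c : ℂ) : HasACDeriv (fun x : ℝ => Complex.exp (c * x))
    (fun x : ℝ => c * Complex.exp (c * x)) := by
  have h : ContDiff ℝ 1 (fun x : ℝ => Complex.exp (c * x)) := by
    have : ContDiff ℝ 1 (fun x : ℝ => (x : ℂ)) := Complex.ofRealCLM.contDiff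
    exact (contDiff_const.mul this).cexp
  refine (of_contDiff h).congr (Eventually.of_forall fun x => ?_)
  have h1 : HasDerivAt (fun x : ℝ => c * (x : ℂ)) (c * 1) x :=
    (Complex.ofRealCLM.hasDerivAt (x := x)).const_mul c
  rw [h1.cexp.deriv]
  ring

lemma continuous (hf : HasACDeriv f m) : Continuous f := by
  rw [continuous_iff_continuousAt]
  intro x
  have h := (hf.1 (x - 1) (x + 1)).continuousOn
  rw [Set.uIcc_of_le (by linarith)] at h
  exact h.continuousAt (Icc_mem_nhds (by linarith) (by linarith))

lemma intervalIntegrable (hf : HasACDeriv f m) (a b : ℝ) : IntervalIntegrable m volume a b := by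
  have hr := ((hf.1 a b).lipschitz_comp lipschitzWith_re).intervalIntegrable_deriv.complex_ofReal
  have hi := ((hf.1 a b).lipschitz_comp lipschitzWith_im).intervalIntegrable_deriv.complex_ofReal
  refine (hr.add (hi.const_mul Complex.I)).congr_ae (ae_restrict_of_ae ?_)
  filter_upwards [hf.2] with x hx
  have h1 : HasDerivAt (fun x => (f x).re) (m x).re x :=
    (Complex.reCLM.hasFDerivAt.comp_hasDerivAt x hx)
  have h2 : HasDerivAt (fun x => (f x).im) (m x).im x :=
    (Complex.imCLM.hasFDerivAt.comp_hasDerivAt x hx)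
  rw [h1.deriv, h2.deriv]
  simpa [mul_comm] using Complex.re_add_im (m x)

lemma eq_of_zero (hf : HasACDeriv f (fun _ => 0)) (x y : ℝ) : f x = f y := by
  obtain ⟨C, hC⟩ := (hf.1 x y).const_of_ae_hasDerivAt_zero (by
    filter_upwards [hf.2] with t ht _ using ht)
  rw [hC x (by simp), hC y (by simp)]

end HasACDeriv

lemma absolutelyContinuousOnInterval_integral {m : ℝ → ℂ}
    (hm : ∀ a b, IntervalIntegrable m volume a b) (a b : ℝ) :
    AbsolutelyContinuousOnInterval (fun x => ∫ t in (0 : ℝ)..x, m t) a b := by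
  have key : ∀ (p : ℝ → ℝ), (∀ a b, IntervalIntegrable p volume a b) →
      AbsolutelyContinuousOnInterval (fun x => ∫ t in (0 : ℝ)..x, p t) a b := by
    intro p hp
    -- The base point `0` need not lie between `a` and `b`, so the interval is first enlarged to
    -- contain it.
    refine ((hp (min 0 (min a b)) (max 0 (max a b))
      ).absolutelyContinuousOnInterval_intervalIntegral ?_).mono ?_
    · rw [Set.mem_uIcc]; left; simp
    · rw [Set.uIcc_of_le (by simp : min 0 (min a b) ≤ max 0 (max a b)), Set.uIcc]
      exact Set.Icc_subset_Icc (min_le_right _ _) (le_max_right _ _)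
  have hre : ∀ a b, IntervalIntegrable (fun t => (m t).re) volume a b := fun a b =>
    ⟨(hm a b).1.re, (hm a b).2.re⟩
  have him : ∀ a b, IntervalIntegrable (fun t => (m t).im) volume a b := fun a b =>
    ⟨(hm a b).1.im, (hm a b).2.im⟩
  have h1 := (key _ hre).lipschitz_comp lipschitzWith_ofReal
  have h2 := ((key _ him).lipschitz_comp lipschitzWith_ofReal).const_smul Complex.I
  refine (funext fun x => ?_ : (fun x => ∫ t in (0 : ℝ)..x, m t) = _) ▸ h1.add h2
  simp only [Pi.add_apply, smul_eq_mul]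
  rw [← intervalIntegral.integral_ofReal, ← intervalIntegral.integral_ofReal,
    ← intervalIntegral.integral_const_mul, ← intervalIntegral.integral_add]
  · refine intervalIntegral.integral_congr fun t _ => ?_
    simpa [mul_comm] using (Complex.re_add_im (m t)).symm
  · exact (hre 0 x).complex_ofReal
  · exact (him 0 x).complex_ofReal.const_mul _

namespace HasACDeriv

variable {f g m n : ℝ → ℂ}

lemma integral (hm : ∀ a b, IntervalIntegrable m volume a b) :
    HasACDeriv (fun x => ∫ t in (0 : ℝ)..x, m t) m := by
  refine ⟨absolutelyContinuousOnInterval_integral hm, ?_⟩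
  have hl : LocallyIntegrable m volume := by
    intro x
    refine ⟨Set.Ioc (x - 1) (x + 1), Ioc_mem_nhds (by linarith) (by linarith), ?_⟩
    rw [← intervalIntegrable_iff_integrableOn_Ioc_of_le (by linarith)]
    exact hm _ _
  filter_upwards [LocallyIntegrable.ae_hasDerivAt_integral hl] with x hx using hx 0

lemma integral_eq_sub (hf : HasACDeriv f m) (a b : ℝ) : ∫ t in a..b, m t = f b - f a := by
  have h := (hf.sub (integral hf.intervalIntegrable)).congr (n := fun _ => 0) (by
    filter_upwards with x; simp)
  have h1 := h.eq_of_zero a b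
  have h2 : ∫ t in a..b, m t = (∫ t in (0 : ℝ)..b, m t) - ∫ t in (0 : ℝ)..a, m t :=
    (intervalIntegral.integral_interval_sub_left (hf.intervalIntegrable _ _)
      (hf.intervalIntegrable _ _)).symm
  rw [h2]
  linear_combination h1

/-- The translate is recovered as the primitive of the translated derivative, so neither absolute
continuity nor null sets have to be transported by hand. -/
lemma comp_add_const (hf : HasACDeriv f m) (c : ℝ) :
    HasACDeriv (fun x => f (x + c)) (fun x => m (x + c)) := by
  have h := (HasACDeriv.const (f c)).add (integral (m := fun x => m (x + c)) fun a b => by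
    simpa using (hf.intervalIntegrable (a + c) (b + c)).comp_add_right c)
  refine (h.congr_fun (g := fun x => f (x + c)) fun x => ?_).congr
    (Eventually.of_forall fun x => by simp)
  rw [intervalIntegral.integral_comp_add_right, hf.integral_eq_sub]
  simp

end HasACDeriv

/-! ### Linear Volterra equations with locally integrable coefficients -/

/-- With `B` the primitive of `a`, `(Bⁿ⁺¹)' = (n + 1) a Bⁿ` almost everywhere. The absolute values
cover negative `x`, where `B ≤ 0` and only a global sign changes. This is the source of the
factorials in the Picard bounds when the coefficient is merely integrable. -/
lemma abs_integral_mul_abs_primitive_pow {a : ℝ → ℝ} (ha : ∀ s t, IntervalIntegrable a volume s t)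
    (h0 : ∀ t, 0 ≤ a t) (n : ℕ) (x : ℝ) :
    |∫ t in (0 : ℝ)..x, a t * |∫ s in (0 : ℝ)..t, a s| ^ n|
      = |∫ s in (0 : ℝ)..x, a s| ^ (n + 1) / (n + 1) := by
  have hac : HasACDeriv (fun x => ((∫ s in (0 : ℝ)..x, a s : ℝ) : ℂ)) (fun x => (a x : ℂ)) := by
    refine (HasACDeriv.integral fun s t => (ha s t).complex_ofReal).congr_fun fun x => ?_
    exact intervalIntegral.integral_ofReal
  have hpow : ∀ n : ℕ, HasACDeriv (fun x => ((∫ s in (0 : ℝ)..x, a s : ℝ) : ℂ) ^ (n + 1))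
      (fun x => (n + 1) * (a x * ((∫ s in (0 : ℝ)..x, a s : ℝ) : ℂ) ^ n)) := by
    intro n
    induction n with
    | zero => simpa using hac
    | succ k ih =>
      refine ((ih.mul hac).congr_fun fun x => by ring).congr (Eventually.of_forall fun x => ?_)
      push_cast
      ring
  have key : ∫ t in (0 : ℝ)..x, a t * (∫ s in (0 : ℝ)..t, a s) ^ n
      = (∫ s in (0 : ℝ)..x, a s) ^ (n + 1) / (n + 1) := by
    have h := (hpow n).integral_eq_sub 0 x
    rw [intervalIntegral.integral_const_mul] at h
    have hn : ((n : ℂ) + 1) ≠ 0 := by exact_mod_cast Nat.succ_ne_zero n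
    have h' : ((∫ t in (0 : ℝ)..x, a t * (∫ s in (0 : ℝ)..t, a s) ^ n : ℝ) : ℂ)
        = (((∫ s in (0 : ℝ)..x, a s) ^ (n + 1) / (n + 1) : ℝ) : ℂ) := by
      rw [← intervalIntegral.integral_ofReal]
      push_cast
      rw [eq_div_iff hn, mul_comm, h]
      simp
    exact_mod_cast h'
  have hmul : |∫ t in (0 : ℝ)..x, a t * |∫ s in (0 : ℝ)..t, a s| ^ n|
      = |∫ t in (0 : ℝ)..x, a t * (∫ s in (0 : ℝ)..t, a s) ^ n| := by
    rcases le_total 0 x with hx | hx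
    · congr 1
      refine intervalIntegral.integral_congr fun t ht => ?_
      rw [Set.uIcc_of_le hx] at ht
      rw [abs_of_nonneg (intervalIntegral.integral_nonneg ht.1 fun s _ => h0 s)]
    · have : ∫ t in (0 : ℝ)..x, a t * |∫ s in (0 : ℝ)..t, a s| ^ n
          = (-1) ^ n * ∫ t in (0 : ℝ)..x, a t * (∫ s in (0 : ℝ)..t, a s) ^ n := by
        rw [← intervalIntegral.integral_const_mul]
        refine intervalIntegral.integral_congr fun t ht => ?_
        rw [Set.uIcc_of_ge hx] at ht
        rw [abs_of_nonpos, neg_pow]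
        · ring
        · rw [intervalIntegral.integral_symm, neg_nonpos]
          exact intervalIntegral.integral_nonneg ht.2 fun s _ => h0 s
      rw [this, abs_mul, abs_pow]
      simp
  rw [hmul, key, abs_div, abs_pow, abs_of_nonneg (by positivity : (0 : ℝ) ≤ n + 1)]

section Volterra

variable {𝔸 : Type*} [NormedRing 𝔸] [NormedAlgebra ℝ 𝔸]

/-- The Picard iterates of `y' = A y`, `y(0) = 1`. -/
noncomputable def picard (A : ℝ → 𝔸) : ℕ → ℝ → 𝔸
  | 0 => fun _ => 1
  | n + 1 => fun x => ∫ t in (0 : ℝ)..x, A t * picard A n t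

variable {A : ℝ → 𝔸}

lemma continuous_picard (hA : ∀ a b, IntervalIntegrable A volume a b) (n : ℕ) :
    Continuous (picard A n) := by
  induction n with
  | zero => exact continuous_const
  | succ k ih =>
    exact intervalIntegral.continuous_primitive
      (fun a b => (hA a b).mul_continuousOn ih.continuousOn) 0

lemma norm_picard_le (hA : ∀ a b, IntervalIntegrable A volume a b) (n : ℕ) (x : ℝ) :
    ‖picard A n x‖ ≤ ‖(1 : 𝔸)‖ * (|∫ s in (0 : ℝ)..x, ‖A s‖| ^ n / n.factorial) := by
  have hn : ∀ a b, IntervalIntegrable (fun t => ‖A t‖) volume a b := fun a b => (hA a b).norm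
  have hB : Continuous fun x : ℝ => ∫ s in (0 : ℝ)..x, ‖A s‖ :=
    intervalIntegral.continuous_primitive hn 0
  induction n generalizing x with
  | zero => simp [picard]
  | succ k ih =>
    have h1 : ‖picard A (k + 1) x‖ ≤ |∫ t in (0 : ℝ)..x, ‖(1 : 𝔸)‖ / k.factorial *
        (‖A t‖ * |∫ s in (0 : ℝ)..t, ‖A s‖| ^ k)| := by
      refine intervalIntegral.norm_integral_le_abs_of_norm_le (ae_of_all _ fun t => ?_) ?_
      · refine (norm_mul_le _ _).trans ((mul_le_mul_of_nonneg_left (ih t)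
          (norm_nonneg _)).trans (le_of_eq ?_))
        ring
      · exact ((hn 0 x).mul_continuousOn (hB.abs.pow k).continuousOn).const_mul _
    refine h1.trans (le_of_eq ?_)
    rw [intervalIntegral.integral_const_mul, abs_mul,
      abs_integral_mul_abs_primitive_pow hn (fun t => norm_nonneg _), Nat.factorial_succ,
      abs_of_nonneg (by positivity)]
    push_cast
    field_simp

/-- The linear Volterra equation `y(x) = 1 + ∫₀ˣ A y` is solvable for locally integrable `A`. -/
theorem exists_volterra [CompleteSpace 𝔸] (hA : ∀ a b, IntervalIntegrable A volume a b) :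
    ∃ y : ℝ → 𝔸, Continuous y ∧ ∀ x, y x = 1 + ∫ t in (0 : ℝ)..x, A t * y t := by
  have hn : ∀ a b, IntervalIntegrable (fun t => ‖A t‖) volume a b := fun a b => (hA a b).norm
  have hB : Continuous fun x : ℝ => |∫ s in (0 : ℝ)..x, ‖A s‖| :=
    (intervalIntegral.continuous_primitive hn 0).abs
  have hsum : ∀ x, Summable fun n => picard A n x := fun x =>
    Summable.of_norm_bounded ((Real.summable_pow_div_factorial _).mul_left _)
      fun n => norm_picard_le hA n x
  refine ⟨fun x => ∑' n, picard A n x, ?_, fun x => ?_⟩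
  · rw [continuous_iff_continuousAt]
    intro x
    obtain ⟨K, hK⟩ := (isCompact_Icc (a := x - 1) (b := x + 1)).exists_bound_of_continuousOn
      hB.continuousOn
    refine ContinuousOn.continuousAt (s := Set.Icc (x - 1) (x + 1)) ?_
      (Icc_mem_nhds (by linarith) (by linarith))
    refine continuousOn_tsum (fun n => (continuous_picard hA n).continuousOn)
      ((Real.summable_pow_div_factorial K).mul_left ‖(1 : 𝔸)‖) fun n t ht => ?_
    refine (norm_picard_le hA n t).trans ?_
    gcongr
    simpa using hK t ht
  · have h : HasSum (fun n => ∫ t in (0 : ℝ)..x, A t * picard A n t)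
        (∫ t in (0 : ℝ)..x, A t * ∑' n, picard A n t) := by
      refine intervalIntegral.hasSum_integral_of_dominated_convergence
        (fun n t => ‖A t‖ * (‖(1 : 𝔸)‖ * (|∫ s in (0 : ℝ)..t, ‖A s‖| ^ n / n.factorial)))
        (fun n => ?_) (fun n => ae_of_all _ fun t _ => ?_) (ae_of_all _ fun t _ => ?_) ?_
        (ae_of_all _ fun t _ => ?_)
      · exact ((hA 0 x).mul_continuousOn (continuous_picard hA n).continuousOn).def'.1
      · exact (norm_mul_le _ _).trans
          (mul_le_mul_of_nonneg_left (norm_picard_le hA n t) (norm_nonneg _))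
      · exact ((Real.summable_pow_div_factorial _).mul_left _).mul_left _
      · have : ∀ t, ∑' n : ℕ, ‖A t‖ * (‖(1 : 𝔸)‖ * (|∫ s in (0 : ℝ)..t, ‖A s‖| ^ n / n.factorial))
            = ‖A t‖ * (‖(1 : 𝔸)‖ * Real.exp |∫ s in (0 : ℝ)..t, ‖A s‖|) := by
          intro t
          rw [tsum_mul_left, tsum_mul_left, Real.exp_eq_exp_ℝ, NormedSpace.exp_eq_tsum_div]
        simp only [this]
        exact (hn 0 x).mul_continuousOn (continuous_const.mul hB.rexp).continuousOn
      · exact (hsum t).hasSum.mul_left _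
    beta_reduce
    rw [(hsum x).tsum_eq_zero_add, ← h.tsum_eq]
    rfl

end Volterra

/-! ### The differential equation in coordinates -/

lemma integrable_star {f : ℝ → ℂ} {μ : Measure ℝ} (hf : Integrable f μ) :
    Integrable (fun x => star (f x)) μ :=
  hf.congr' (continuous_star.comp_aestronglyMeasurable hf.1) (ae_of_all _ fun x => by simp)

namespace IsPotential

variable {v : Fin 2 → ℝ → ℂ}

lemma intervalIntegrable (hv : IsPotential v) (i : Fin 2) (a b : ℝ) :
    IntervalIntegrable (v i) volume a b := by
  refine (hv.periodic i).intervalIntegrable (t := 0) one_ne_zero ?_ a b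
  rw [zero_add, intervalIntegrable_iff_integrableOn_Ioc_of_le zero_le_one]
  exact (hv.memLp i).integrable one_le_two

lemma intervalIntegrable_star (hv : IsPotential v) (i : Fin 2) (a b : ℝ) :
    IntervalIntegrable (fun x => star (v i x)) volume a b :=
  ⟨integrable_star (hv.intervalIntegrable i a b).1, integrable_star (hv.intervalIntegrable i a b).2⟩

lemma intervalIntegrable_sq (hv : IsPotential v) (i : Fin 2) (a b : ℝ) :
    IntervalIntegrable (fun x => ‖v i x‖ ^ 2) volume a b := by
  refine Function.Periodic.intervalIntegrable (t := 0) (T := 1) (fun x => ?_) one_ne_zero ?_ a b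
  · simp only [hv.periodic i x]
  · rw [zero_add, intervalIntegrable_iff_integrableOn_Ioc_of_le zero_le_one]
    exact (memLp_two_iff_integrable_sq_norm (hv.memLp i).1).1 (hv.memLp i)

end IsPotential

lemma locallyIntegrable_of_intervalIntegrable {E : Type*} [NormedAddCommGroup E] {m : ℝ → E}
    (hm : ∀ a b, IntervalIntegrable m volume a b) : LocallyIntegrable m volume := by
  intro x
  refine ⟨Set.Ioc (x - 1) (x + 1), Ioc_mem_nhds (by linarith) (by linarith), ?_⟩
  rw [← intervalIntegrable_iff_integrableOn_Ioc_of_le (by linarith)]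
  exact hm _ _

lemma IsPotential.aestronglyMeasurable {v : Fin 2 → ℝ → ℂ} (hv : IsPotential v) (i : Fin 2) :
    AEStronglyMeasurable (v i) volume :=
  (locallyIntegrable_of_intervalIntegrable (hv.intervalIntegrable i)).aestronglyMeasurable

lemma lipschitzWith_coord (i : Fin 3) : LipschitzWith 1 (fun w : C3 => w i) :=
  LipschitzWith.of_dist_le_mul fun z w => by
    simpa [dist_eq_norm] using PiLp.norm_apply_le (z - w) i

lemma hasDerivAt_iff_coord {u : ℝ → C3} {p : C3} {x : ℝ} :
    HasDerivAt u p x ↔ ∀ i, HasDerivAt (fun t => u t i) (p i) x := by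
  constructor
  · intro h i
    exact (EuclideanSpace.proj (𝕜 := ℂ) i |>.restrictScalars ℝ).hasFDerivAt.comp_hasDerivAt x h
  · intro h
    have h1 : HasDerivAt (fun t => (u t).ofLp) p.ofLp x := hasDerivAt_pi.2 h
    exact ((EuclideanSpace.equiv (Fin 3) ℂ).symm.toContinuousLinearMap.restrictScalars
      ℝ).hasFDerivAt.comp_hasDerivAt x h1

lemma absolutelyContinuousOnInterval_iff_coord {u : ℝ → C3} {a b : ℝ} :
    AbsolutelyContinuousOnInterval u a b ↔
      ∀ i, AbsolutelyContinuousOnInterval (fun x => u x i) a b := by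
  refine ⟨fun h i => h.lipschitz_comp (lipschitzWith_coord i), fun h => ?_⟩
  have h' : Tendsto (fun E : ℕ × (ℕ → ℝ × ℝ) => ∑ i, ∑ k ∈ Finset.range E.1,
      dist (u (E.2 k).1 i) (u (E.2 k).2 i))
      (AbsolutelyContinuousOnInterval.totalLengthFilter ⊓
        𝓟 (AbsolutelyContinuousOnInterval.disjWithin a b)) (𝓝 0) := by
    -- The Euclidean distance is at most the sum of the coordinate distances, and that sum is
    -- controlled here.
    simpa using tendsto_finsetSum Finset.univ fun i _ => h i
  refine squeeze_zero (fun E => Finset.sum_nonneg fun i _ => dist_nonneg) (fun E => ?_) h'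
  rw [Finset.sum_comm]
  refine Finset.sum_le_sum fun k _ => ?_
  rw [EuclideanSpace.dist_eq]
  refine Real.sqrt_le_iff.2 ⟨Finset.sum_nonneg fun i _ => dist_nonneg, ?_⟩
  exact Finset.sum_sq_le_sq_sum_of_nonneg fun i _ => dist_nonneg

lemma expr_apply_zero (v : Fin 2 → ℝ → ℂ) (x : ℝ) (w p : C3) :
    expr v x w p 0 = Complex.I * p 0 + (star (v 0 x) * w 1 + star (v 1 x) * w 2) := by
  simp [expr, J, V, dotProduct, Fin.sum_univ_three]

lemma expr_apply_one (v : Fin 2 → ℝ → ℂ) (x : ℝ) (w p : C3) :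
    expr v x w p 1 = -(Complex.I * p 1) + v 0 x * w 0 := by
  simp [expr, J, V, dotProduct, Fin.sum_univ_three]

lemma expr_apply_two (v : Fin 2 → ℝ → ℂ) (x : ℝ) (w p : C3) :
    expr v x w p 2 = -(Complex.I * p 2) + v 1 x * w 0 := by
  simp [expr, J, V, dotProduct, Fin.sum_univ_three]

lemma expr_eq_iff (v : Fin 2 → ℝ → ℂ) (x : ℝ) (w p g : C3) :
    expr v x w p = g ↔
      p 0 = -Complex.I * (g 0 - star (v 0 x) * w 1 - star (v 1 x) * w 2) ∧
      p 1 = Complex.I * (g 1 - v 0 x * w 0) ∧ p 2 = Complex.I * (g 2 - v 1 x * w 0) := by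
  have hI := Complex.I_mul_I
  rw [PiLp.ext_iff, Fin.forall_fin_succ, Fin.forall_fin_two]
  simp only [Fin.succ_zero_eq_one, Fin.succ_one_eq_two, expr_apply_zero, expr_apply_one,
    expr_apply_two]
  refine and_congr ?_ (and_congr ?_ ?_)
  · constructor <;> intro h
    · linear_combination (-Complex.I) * h + p 0 * hI
    · rw [h]
      linear_combination (-(g 0 - star (v 0 x) * w 1 - star (v 1 x) * w 2)) * hI
  · constructor <;> intro h
    · linear_combination Complex.I * h + p 1 * hI
    · rw [h]
      linear_combination (-(g 1 - v 0 x * w 0)) * hI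
  · constructor <;> intro h
    · linear_combination Complex.I * h + p 2 * hI
    · rw [h]
      linear_combination (-(g 2 - v 1 x * w 0)) * hI

/-- The first order system in coordinates. -/
lemma solves_iff {v : Fin 2 → ℝ → ℂ} {u g : ℝ → C3} :
    Solves v u g ↔
      HasACDeriv (fun x => u x 0)
        (fun x => -Complex.I * (g x 0 - star (v 0 x) * u x 1 - star (v 1 x) * u x 2)) ∧
      HasACDeriv (fun x => u x 1) (fun x => Complex.I * (g x 1 - v 0 x * u x 0)) ∧
      HasACDeriv (fun x => u x 2) (fun x => Complex.I * (g x 2 - v 1 x * u x 0)) := by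
  constructor
  · rintro ⟨hac, hd⟩
    have hd' : ∀ᵐ x, ∃ p : C3, (∀ i, HasDerivAt (fun t => u t i) (p i) x) ∧
        (p 0 = -Complex.I * (g x 0 - star (v 0 x) * u x 1 - star (v 1 x) * u x 2) ∧
        p 1 = Complex.I * (g x 1 - v 0 x * u x 0) ∧
        p 2 = Complex.I * (g x 2 - v 1 x * u x 0)) := by
      filter_upwards [hd] with x ⟨p, hp, he⟩
      exact ⟨p, hasDerivAt_iff_coord.1 hp, (expr_eq_iff _ _ _ _ _).1 he⟩
    refine ⟨⟨fun a b => absolutelyContinuousOnInterval_iff_coord.1 (hac a b) 0, ?_⟩,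
      ⟨fun a b => absolutelyContinuousOnInterval_iff_coord.1 (hac a b) 1, ?_⟩,
      ⟨fun a b => absolutelyContinuousOnInterval_iff_coord.1 (hac a b) 2, ?_⟩⟩
    · filter_upwards [hd'] with x ⟨p, hp, he⟩
      exact he.1 ▸ hp 0
    · filter_upwards [hd'] with x ⟨p, hp, he⟩
      exact he.2.1 ▸ hp 1
    · filter_upwards [hd'] with x ⟨p, hp, he⟩
      exact he.2.2 ▸ hp 2
  · rintro ⟨h0, h1, h2⟩
    refine ⟨fun a b => absolutelyContinuousOnInterval_iff_coord.2 fun i => ?_, ?_⟩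
    · fin_cases i
      exacts [h0.1 a b, h1.1 a b, h2.1 a b]
    · filter_upwards [h0.2, h1.2, h2.2] with x d0 d1 d2
      refine ⟨!₂[_, _, _], hasDerivAt_iff_coord.2 fun i => ?_, (expr_eq_iff _ _ _ _ _).2
        ⟨rfl, rfl, rfl⟩⟩
      fin_cases i
      exacts [d0, d1, d2]

namespace Solves

variable {v : Fin 2 → ℝ → ℂ} {u w g h : ℝ → C3}

lemma add (hu : Solves v u g) (hw : Solves v w h) :
    Solves v (fun x => u x + w x) (fun x => g x + h x) := by
  refine ⟨fun a b => (hu.1 a b).add (hw.1 a b), ?_⟩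
  filter_upwards [hu.2, hw.2] with x ⟨p, hp, he⟩ ⟨q, hq, hf⟩
  exact ⟨p + q, hp.add hq, by rw [expr_add, he, hf]⟩

lemma const_smul (c : ℂ) (hu : Solves v u g) :
    Solves v (fun x => c • u x) (fun x => c • g x) := by
  refine ⟨fun a b => (hu.1 a b).const_smul c, ?_⟩
  filter_upwards [hu.2] with x ⟨p, hp, he⟩
  exact ⟨c • p, hp.const_smul c, by rw [expr_smul, he]⟩

lemma congr (hu : Solves v u g) (hg : g =ᵐ[volume] h) : Solves v u h := by
  refine ⟨hu.1, ?_⟩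
  filter_upwards [hu.2, hg] with x ⟨p, hp, he⟩ hx
  exact ⟨p, hp, he.trans hx⟩

lemma hasACDeriv_coord (hu : Solves v u g) (i : Fin 3) : ∃ m, HasACDeriv (fun x => u x i) m := by
  obtain ⟨h0, h1, h2⟩ := solves_iff.1 hu
  fin_cases i
  exacts [⟨_, h0⟩, ⟨_, h1⟩, ⟨_, h2⟩]

lemma continuous (hu : Solves v u g) : Continuous u := by
  have : Continuous fun x => (u x).ofLp := continuous_pi fun i =>
    (hu.hasACDeriv_coord i).elim fun _ h => h.continuous
  exact (EuclideanSpace.equiv (Fin 3) ℂ).symm.continuous.comp this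

/-- Translation invariance of the equation, for a periodic potential. -/
lemma comp_add_one (hv : IsPotential v) (hu : Solves v u g) :
    Solves v (fun x => u (x + 1)) (fun x => g (x + 1)) := by
  obtain ⟨h0, h1, h2⟩ := solves_iff.1 hu
  have e0 : ∀ x, v 0 (x + 1) = v 0 x := hv.periodic 0
  have e1 : ∀ x, v 1 (x + 1) = v 1 x := hv.periodic 1
  refine solves_iff.2 ⟨?_, ?_, ?_⟩
  · simpa only [e0, e1] using h0.comp_add_const 1
  · simpa only [e0, e1] using h1.comp_add_const 1
  · simpa only [e0, e1] using h2.comp_add_const 1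

end Solves

/-- The indefinite form `w* J u`. -/
def form (w u : C3) : ℂ := star (w 0) * u 0 - star (w 1) * u 1 - star (w 2) * u 2

/-- The Lagrange identity. -/
lemma hasACDeriv_form {v : Fin 2 → ℝ → ℂ} {u w g h : ℝ → C3} (hw : Solves v w h)
    (hu : Solves v u g) :
    HasACDeriv (fun x => form (w x) (u x))
      (fun x => Complex.I * (inner ℂ (h x) (u x) - inner ℂ (w x) (g x))) := by
  obtain ⟨h0, h1, h2⟩ := solves_iff.1 hu
  obtain ⟨k0, k1, k2⟩ := solves_iff.1 hw
  refine (((k0.star.mul h0).sub (k1.star.mul h1)).sub (k2.star.mul h2)).congr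
    (Eventually.of_forall fun x => ?_)
  simp only [PiLp.inner_apply, Fin.sum_univ_three, RCLike.inner_apply, Complex.star_def, map_mul,
    map_sub, map_neg, Complex.conj_I, Complex.conj_conj]
  ring

/-- For solutions to conjugate spectral parameters the form is constant. -/
lemma form_eq_form {v : Fin 2 → ℝ → ℂ} {u w : ℝ → C3} {z : ℂ}
    (hw : Solves v w (fun x => star z • w x)) (hu : Solves v u (fun x => z • u x)) (x y : ℝ) :
    form (w x) (u x) = form (w y) (u y) := by
  refine ((hasACDeriv_form hw hu).congr (Eventually.of_forall fun t => ?_)).eq_of_zero x y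
  simp only [inner_smul_left, inner_smul_right]
  simp

/-! ### The fundamental solution and the monodromy matrix -/

lemma exists_isFundamentalSolution {v : Fin 2 → ℝ → ℂ} (hv : IsPotential v) (z : ℂ) :
    ∃ y, IsFundamentalSolution v z y := by
  -- The Volterra equation is solved in the Banach algebra of operators on `ℂ³`. The coefficient `A`
  -- is the system solved for `y'`, written as scalar functions times fixed operators so that its
  -- integrability is that of the entries of `V`.
  let E := (Fin 3 → ℂ) →L[ℂ] (Fin 3 → ℂ)
  let op : Matrix (Fin 3) (Fin 3) ℂ → E := fun M =>
    LinearMap.toContinuousLinearMap (Matrix.toLin' M)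
  have hop : ∀ (M : Matrix (Fin 3) (Fin 3) ℂ) (w : Fin 3 → ℂ), op M w = M.mulVec w :=
    fun M w => rfl
  let A : ℝ → E := fun x =>
    op !![-Complex.I * z, 0, 0; 0, Complex.I * z, 0; 0, 0, Complex.I * z]
      + (star (v 0 x)) • op !![0, Complex.I, 0; 0, 0, 0; 0, 0, 0]
      + (star (v 1 x)) • op !![0, 0, Complex.I; 0, 0, 0; 0, 0, 0]
      + (v 0 x) • op !![0, 0, 0; -Complex.I, 0, 0; 0, 0, 0]
      + (v 1 x) • op !![0, 0, 0; 0, 0, 0; -Complex.I, 0, 0]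
  have hsm : ∀ (f : ℝ → ℂ) (M : E) (a b : ℝ),
      IntervalIntegrable f volume a b → IntervalIntegrable (fun x => f x • M) volume a b :=
    fun f M a b hf => ⟨hf.1.smul_const M, hf.2.smul_const M⟩
  have hA : ∀ a b, IntervalIntegrable A volume a b := fun a b =>
    (((intervalIntegrable_const.add (hsm _ _ a b (hv.intervalIntegrable_star 0 a b))).add
      (hsm _ _ a b (hv.intervalIntegrable_star 1 a b))).add
      (hsm _ _ a b (hv.intervalIntegrable 0 a b))).add (hsm _ _ a b (hv.intervalIntegrable 1 a b))
  obtain ⟨y, hyc, hy⟩ := exists_volterra hA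
  have hAy : ∀ a b, IntervalIntegrable (fun t => A t * y t) volume a b := fun a b =>
    (hA a b).mul_continuousOn hyc.continuousOn
  have hent : ∀ i j, HasACDeriv (fun x => y x (Pi.single j 1) i)
      (fun x => A x (y x (Pi.single j 1)) i) := by
    intro i j
    let L : E →L[ℝ] ℂ := ((ContinuousLinearMap.proj (R := ℂ) i).comp
      (ContinuousLinearMap.apply ℂ (Fin 3 → ℂ) (Pi.single j 1))).restrictScalars ℝ
    have h1 : ∀ x, y x (Pi.single j 1) i = (Pi.single j 1 : Fin 3 → ℂ) i
        + ∫ t in (0 : ℝ)..x, A t (y t (Pi.single j 1)) i := by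
      intro x
      have := L.intervalIntegral_comp_comm (hAy 0 x)
      have h2 := congrArg L (hy x)
      rw [map_add, ← this] at h2
      exact h2
    have h2 : ∀ a b, IntervalIntegrable (fun t => A t (y t (Pi.single j 1)) i) volume a b :=
      fun a b => ⟨L.integrable_comp (hAy a b).1, L.integrable_comp (hAy a b).2⟩
    exact ((HasACDeriv.const _).add (HasACDeriv.integral h2)).congr_fun
      (fun x => (h1 x).symm) |>.congr (Eventually.of_forall fun x => by simp)
  refine ⟨fun x => Matrix.of fun i j => y x (Pi.single j 1) i, ?_, fun j =>
    solves_iff.2 ⟨?_, ?_, ?_⟩⟩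
  · ext i j
    have : y 0 = 1 := by simpa using hy 0
    simp [this, Matrix.one_apply, Pi.single_apply]
  · refine (hent 0 j).congr (Eventually.of_forall fun x => ?_)
    simp [A, hop, column, dotProduct, Fin.sum_univ_three]
    ring
  · refine (hent 1 j).congr (Eventually.of_forall fun x => ?_)
    simp [A, hop, column, dotProduct, Fin.sum_univ_three]
    ring
  · refine (hent 2 j).congr (Eventually.of_forall fun x => ?_)
    simp [A, hop, column, dotProduct, Fin.sum_univ_three]
    ring

lemma form_column (y₁ y₂ : ℝ → Matrix (Fin 3) (Fin 3) ℂ) (x : ℝ) (i j : Fin 3) :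
    form (column y₁ i x) (column y₂ j x) = ((y₁ x).conjTranspose * J * y₂ x) i j := by
  simp [form, column, J, Matrix.mul_apply, Fin.sum_univ_three]
  ring

lemma J_mul_J : J * J = 1 := by
  ext i j
  fin_cases i <;> fin_cases j <;> simp [J, Matrix.mul_apply, Fin.sum_univ_three]

/-- The symplectic-type identity `y(x, z̄)* J y(x, z) = J`. -/
lemma conjTranspose_mul_J_mul {v : Fin 2 → ℝ → ℂ} {z : ℂ} {y₁ y₂ : ℝ → Matrix (Fin 3) (Fin 3) ℂ}
    (h₁ : IsFundamentalSolution v (star z) y₁) (h₂ : IsFundamentalSolution v z y₂) (x : ℝ) :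
    (y₁ x).conjTranspose * J * y₂ x = J := by
  ext i j
  rw [← form_column, form_eq_form (h₁.2 i) (h₂.2 j) x 0, form_column, h₁.1, h₂.1]
  simp

/-- A solution of the homogeneous equation that vanishes at `0` is zero. -/
lemma Solves.eq_zero {v : Fin 2 → ℝ → ℂ} (hv : IsPotential v) {z : ℂ} {u : ℝ → C3}
    (hu : Solves v u (fun x => z • u x)) (h0 : u 0 = 0) (x : ℝ) : u x = 0 := by
  -- Uniqueness follows from duality: the form of `u` against each column of a fundamental solution
  -- at `z̄` is constant, hence zero, and `y₁* J` is invertible by the `J`-identity.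
  obtain ⟨y₁, h₁⟩ := exists_isFundamentalSolution hv (star z)
  obtain ⟨y₂, h₂⟩ := exists_isFundamentalSolution hv z
  have hJ := conjTranspose_mul_J_mul h₁ h₂ x
  have hz : ((y₁ x).conjTranspose * J).mulVec (u x).ofLp = 0 := by
    ext i
    have h := form_eq_form (h₁.2 i) hu x 0
    rw [h0] at h
    simp [form, column] at h
    simp [Matrix.mulVec, dotProduct, Matrix.mul_apply, Fin.sum_univ_three, J]
    linear_combination h
  have hinv : (y₂ x * J) * ((y₁ x).conjTranspose * J) = 1 := by
    rw [mul_eq_one_comm, ← mul_assoc, hJ, J_mul_J]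
  have : (u x).ofLp = 0 := by
    rw [← Matrix.one_mulVec (u x).ofLp, ← hinv, ← Matrix.mulVec_mulVec, hz, Matrix.mulVec_zero]
  ext i
  simpa using congrFun this i

/-- Two solutions of the homogeneous equation that agree at `0` are equal. -/
lemma Solves.eq_of_eq {v : Fin 2 → ℝ → ℂ} (hv : IsPotential v) {z : ℂ} {u w : ℝ → C3}
    (hu : Solves v u (fun x => z • u x)) (hw : Solves v w (fun x => z • w x)) (h0 : u 0 = w 0)
    (x : ℝ) : u x = w x := by
  have h : Solves v (fun x => u x + (-1 : ℂ) • w x) (fun x => z • (u x + (-1 : ℂ) • w x)) :=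
    (hu.add (hw.const_smul (-1))).congr (Eventually.of_forall fun t => by
      simp only [smul_add, smul_comm z])
  have := h.eq_zero hv (by simp [h0]) x
  simpa [add_neg_eq_zero] using this

lemma existsUnique_isFundamentalSolution {v : Fin 2 → ℝ → ℂ} (hv : IsPotential v) (z : ℂ) :
    ∃! y, IsFundamentalSolution v z y := by
  obtain ⟨y, hy⟩ := exists_isFundamentalSolution hv z
  refine ⟨y, hy, fun w hw => ?_⟩
  funext x
  ext i j
  have h := (hw.2 j).eq_of_eq hv (hy.2 j) (by simp [column, hw.1, hy.1]) x
  simpa [column] using congrArg (fun p : C3 => p i) h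

lemma isFundamentalSolution_fundamentalSolution {v : Fin 2 → ℝ → ℂ} (hv : IsPotential v) (z : ℂ) :
    IsFundamentalSolution v z (fundamentalSolution v z) :=
  Classical.epsilon_spec (exists_isFundamentalSolution hv z)

lemma exp_neg_I_mul_mul_exp (z : ℂ) :
    Complex.exp (-Complex.I * z) * Complex.exp (Complex.I * z) = 1 := by
  rw [← Complex.exp_add]
  simp

/-- Liouville's formula: the system matrix has trace `-iz + iz + iz = iz`, the off-diagonal
potential contributing nothing, so `e^{-izx} det y(x)` has zero derivative. -/
lemma det_monodromy {v : Fin 2 → ℝ → ℂ} (hv : IsPotential v) (z : ℂ) :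
    (monodromy v z).det = Complex.exp (Complex.I * z) := by
  have hy := isFundamentalSolution_fundamentalSolution hv z
  set y := fundamentalSolution v z with hydef
  have hc := fun j => solves_iff.1 (hy.2 j)
  have hd : HasACDeriv (fun x : ℝ => Complex.exp (-Complex.I * z * x) * (y x).det)
      (fun _ => 0) := by
    obtain ⟨a0, b0, c0⟩ := hc 0
    obtain ⟨a1, b1, c1⟩ := hc 1
    obtain ⟨a2, b2, c2⟩ := hc 2
    refine (((HasACDeriv.exp (-Complex.I * z)).mul ((((((a0.mul (b1.mul c2)).sub
      (a0.mul (b2.mul c1))).sub (a1.mul (b0.mul c2))).add (a1.mul (b2.mul c0))).add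
      (a2.mul (b0.mul c1))).sub (a2.mul (b1.mul c0)))).congr_fun fun x => ?_).congr
      (Eventually.of_forall fun x => ?_)
    · simp only [column, Matrix.det_fin_three]
      ring
    · simp only [column, PiLp.smul_apply, smul_eq_mul]
      ring
  have h := hd.eq_of_zero 1 0
  rw [hy.1] at h
  have h1 : Complex.exp (-Complex.I * z) * (y 1).det = 1 := by simpa using h
  have h2 := exp_neg_I_mul_mul_exp z
  have h3 : Complex.exp (-Complex.I * z) ≠ 0 := Complex.exp_ne_zero _
  exact mul_left_cancel₀ h3 (h1.trans h2.symm)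

lemma monodromy_conjTranspose {v : Fin 2 → ℝ → ℂ} (hv : IsPotential v) (z : ℂ) :
    (monodromy v (star z)).conjTranspose * J * monodromy v z = J :=
  conjTranspose_mul_J_mul (isFundamentalSolution_fundamentalSolution hv _)
    (isFundamentalSolution_fundamentalSolution hv _) 1

/-- The adjugate is the determinant times the inverse, and the inverse is `J ψ(z̄)* J`, whose trace
is that of `ψ(z̄)*`. -/
lemma trace_adjugate_monodromy {v : Fin 2 → ℝ → ℂ} (hv : IsPotential v) (z : ℂ) :
    (monodromy v z).adjugate.trace = Complex.exp (Complex.I * z) * Ttilde v z := by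
  have h1 : (J * (monodromy v (star z)).conjTranspose * J) * monodromy v z = 1 := by
    rw [mul_assoc, mul_assoc, ← mul_assoc _ J, monodromy_conjTranspose hv, J_mul_J]
  have h2 : (monodromy v z).adjugate
      = Complex.exp (Complex.I * z) • (J * (monodromy v (star z)).conjTranspose * J) := by
    calc (monodromy v z).adjugate
        = ((J * (monodromy v (star z)).conjTranspose * J) * monodromy v z)
          * (monodromy v z).adjugate := by rw [h1, one_mul]
      _ = _ := by rw [mul_assoc, Matrix.mul_adjugate, det_monodromy hv, Matrix.mul_smul, mul_one]
  rw [h2, Matrix.trace_smul, Matrix.trace_mul_comm, ← mul_assoc, J_mul_J, one_mul,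
    Matrix.trace_conjTranspose]
  rfl

lemma det_sub_smul_one (M : Matrix (Fin 3) (Fin 3) ℂ) (τ : ℂ) :
    (M - τ • 1).det = -τ ^ 3 + τ ^ 2 * M.trace - τ * M.adjugate.trace + M.det := by
  simp [Matrix.det_fin_three, Matrix.trace_fin_three, Matrix.adjugate_fin_three]
  ring

lemma D_eq {v : Fin 2 → ℝ → ℂ} (hv : IsPotential v) (τ z : ℂ) :
    D v τ z = -τ ^ 3 + τ ^ 2 * T v z - τ * Complex.exp (Complex.I * z) * Ttilde v z
      + Complex.exp (Complex.I * z) := by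
  rw [D, det_sub_smul_one, trace_adjugate_monodromy hv, det_monodromy hv, T]
  ring

/-! ### The multipliers -/

lemma eval_charpoly_monodromy {v : Fin 2 → ℝ → ℂ} (z τ : ℂ) :
    (monodromy v z).charpoly.eval τ = -D v τ z := by
  have h : Matrix.scalar (Fin 3) τ - monodromy v z = -(monodromy v z - τ • 1) := by
    rw [neg_sub, Matrix.scalar_apply, ← Matrix.smul_one_eq_diagonal]
  rw [Matrix.eval_charpoly, D, h, Matrix.det_neg]
  simp [pow_succ]

lemma exists_multipliers (v : Fin 2 → ℝ → ℂ) (z : ℂ) :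
    ∃ a b c : ℂ, multipliers v z = {a, b, c} := by
  refine Multiset.card_eq_three.1 ?_
  rw [multipliers, IsAlgClosed.card_roots_eq_natDegree, Matrix.charpoly_natDegree_eq_dim]
  rfl

lemma D_eq_of_multipliers {v : Fin 2 → ℝ → ℂ} {z a b c : ℂ} (h : multipliers v z = {a, b, c})
    (τ : ℂ) : D v τ z = -((τ - a) * (τ - b) * (τ - c)) := by
  have h1 := (IsAlgClosed.splits (monodromy v z).charpoly).eq_prod_roots_of_monic
    (Matrix.charpoly_monic _)
  have h2 := eval_charpoly_monodromy (v := v) z τ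
  rw [h1, ← multipliers, h] at h2
  simp at h2
  rw [mul_assoc, h2, neg_neg]

lemma vieta {v : Fin 2 → ℝ → ℂ} (hv : IsPotential v) {z a b c : ℂ}
    (h : multipliers v z = {a, b, c}) :
    a + b + c = T v z ∧ a * b + b * c + c * a = Complex.exp (Complex.I * z) * Ttilde v z ∧
      a * b * c = Complex.exp (Complex.I * z) := by
  -- Both expressions are cubics with leading coefficient `-1`, so three values determine the
  -- remaining coefficients.
  have h0 := (D_eq_of_multipliers h 0).symm.trans (D_eq hv 0 z)
  have h1 := (D_eq_of_multipliers h 1).symm.trans (D_eq hv 1 z)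
  have h2 := (D_eq_of_multipliers h (-1)).symm.trans (D_eq hv (-1) z)
  refine ⟨?_, ?_, ?_⟩
  · linear_combination (h1 + h2) / 2 - h0
  · linear_combination (h2 - h1) / 2
  · linear_combination h0

lemma multipliers_identities {v : Fin 2 → ℝ → ℂ} (hv : IsPotential v) {z a b c : ℂ}
    (h : multipliers v z = {a, b, c}) :
    Complex.exp (Complex.I * z) = a * b * c ∧
      Ttilde v z = 1 / a + 1 / b + 1 / c ∧
      Ttilde v z = Complex.exp (-Complex.I * z) * (a * b + b * c + c * a) := by
  obtain ⟨-, h2, h3⟩ := vieta hv h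
  have he := exp_neg_I_mul_mul_exp z
  have hne : a * b * c ≠ 0 := h3 ▸ Complex.exp_ne_zero _
  have ha : a ≠ 0 := by rintro rfl; simp at hne
  have hb : b ≠ 0 := by rintro rfl; simp at hne
  have hc : c ≠ 0 := by rintro rfl; simp at hne
  refine ⟨h3.symm, ?_, ?_⟩
  · rw [← h3] at h2
    field_simp
    linear_combination -h2
  · rw [h2, ← mul_assoc, he, one_mul]

/-- For real spectral parameters the multipliers are symmetric with respect to the unit circle. -/
lemma D_inv_star_eq_zero {v : Fin 2 → ℝ → ℂ} (hv : IsPotential v) (t : ℝ) {τ : ℂ} (h0 : τ ≠ 0)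
    (h : D v τ t = 0) : D v (star τ)⁻¹ t = 0 := by
  have hE : star (Complex.exp (Complex.I * t)) * Complex.exp (Complex.I * t) = 1 := by
    rw [Complex.star_def, ← Complex.exp_conj, ← Complex.exp_add]
    simp
  have ht : Ttilde v t = star (T v t) := by simp [Ttilde]
  rw [D_eq hv, ht] at h ⊢
  -- With `σ = τ̄` and `|e| = 1`, multiplying the conjugated equation by `-e` gives `σ³ D(1/σ) = 0`.
  have h' := congrArg star h
  have h0' : star τ ≠ 0 := star_ne_zero.2 h0
  simp only [star_add, star_sub, star_neg, star_mul', star_pow, star_star, star_zero] at h'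
  generalize star τ = σ at *
  generalize star (T v t) = T' at *
  generalize Complex.exp (Complex.I * t) = e at *
  generalize star e = e' at *
  field_simp
  linear_combination (-e) * h' + (1 - σ * T v t) * hE

/-- The fixed points of `τ ↦ 1/τ̄` are exactly the unimodular numbers. Set-level symmetry, without
multiplicities, is enough together with the product condition. -/
lemma countP_norm_eq_one {a b c : ℂ} (habc : ‖a‖ * ‖b‖ * ‖c‖ = 1)
    (hsym : ∀ τ ∈ ({a, b, c} : Set ℂ), (star τ)⁻¹ ∈ ({a, b, c} : Set ℂ))
    (p : DecidablePred fun τ : ℂ => ‖τ‖ = 1) :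
    Multiset.countP (fun τ : ℂ => ‖τ‖ = 1) {a, b, c} = 1 ∨
      Multiset.countP (fun τ : ℂ => ‖τ‖ = 1) {a, b, c} = 3 := by
  have hcount : Multiset.countP (fun τ : ℂ => ‖τ‖ = 1) {a, b, c}
      = (if ‖c‖ = 1 then 1 else 0) + (if ‖b‖ = 1 then 1 else 0) + (if ‖a‖ = 1 then 1 else 0) := by
    simp only [Multiset.insert_eq_cons, ← Multiset.cons_zero, Multiset.countP_cons,
      Multiset.countP_zero, zero_add]
  have hinv : ∀ τ : ℂ, ‖(star τ)⁻¹‖ = ‖τ‖⁻¹ := fun τ => by rw [norm_inv, norm_star]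
  have ha : ‖a‖ ≠ 0 := by rintro h; simp [h] at habc
  have hb : ‖b‖ ≠ 0 := by rintro h; simp [h] at habc
  have hc : ‖c‖ ≠ 0 := by rintro h; simp [h] at habc
  have hself : ∀ τ : ℂ, ‖τ‖ ≠ 0 → (star τ)⁻¹ = τ → ‖τ‖ = 1 := by
    intro τ h0 h
    have h1 := hinv τ
    rw [h] at h1
    have h2 : ‖τ‖ * ‖τ‖ = 1 := by
      nth_rewrite 1 [h1]
      exact inv_mul_cancel₀ h0
    nlinarith [norm_nonneg τ]
  rw [hcount]
  by_cases h1 : ‖a‖ = 1 <;> by_cases h2 : ‖b‖ = 1 <;> by_cases h3 : ‖c‖ = 1 <;>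
    simp only [h1, h2, h3, if_true, if_false] at habc ⊢ <;> norm_num at habc ⊢
  -- Two unimodular members force the third to be unimodular by the product; this is the first of
  -- three such cases.
  · exact h3 habc
  · exact h2 habc
  · exact h1 habc
  -- With no unimodular member, `a` is paired with `b` or `c`. The pair has product of modulus one,
  -- so the remaining member would be unimodular.
  · have hs := hsym a (by simp)
    simp only [Set.mem_insert_iff, Set.mem_singleton_iff] at hs
    rcases hs with hs | hs | hs
    · exact h1 (hself a ha hs)
    · apply h3
      rw [← hs, hinv, mul_inv_cancel₀ ha, one_mul] at habc
      exact habc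
    · apply h2
      rw [← hs, hinv, mul_right_comm, mul_inv_cancel₀ ha, one_mul] at habc
      exact habc

open Classical in
lemma countP_multipliers {v : Fin 2 → ℝ → ℂ} (hv : IsPotential v) (t : ℝ) :
    (multipliers v t).countP (fun τ => ‖τ‖ = 1) = 1 ∨
      (multipliers v t).countP (fun τ => ‖τ‖ = 1) = 3 := by
  obtain ⟨a, b, c, h⟩ := exists_multipliers v t
  have h3 := (vieta hv h).2.2
  have hn : ‖a‖ * ‖b‖ * ‖c‖ = 1 := by
    rw [← norm_mul, ← norm_mul, h3, mul_comm, Complex.norm_exp_ofReal_mul_I]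
  rw [h]
  refine countP_norm_eq_one hn (fun τ hτ => ?_) _
  have h0 : τ ≠ 0 := by
    rintro rfl
    rcases hτ with h | h | h <;> rw [← h] at hn <;> simp at hn
  have hD : D v τ t = 0 := by
    rw [D_eq_of_multipliers h]
    rcases hτ with h | h | h <;> rw [h] <;> ring
  have := D_inv_star_eq_zero hv t h0 hD
  rw [D_eq_of_multipliers h, neg_eq_zero, mul_eq_zero, mul_eq_zero, sub_eq_zero, sub_eq_zero,
    sub_eq_zero] at this
  simpa [or_assoc] using this

lemma spectralPart_one_union_three {v : Fin 2 → ℝ → ℂ} (hv : IsPotential v) :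
    spectralPart v 1 ∪ spectralPart v 3 = Set.univ :=
  Set.eq_univ_of_forall fun t => countP_multipliers hv t

lemma spectralPart_two {v : Fin 2 → ℝ → ℂ} (hv : IsPotential v) : spectralPart v 2 = ∅ := by
  refine Set.eq_empty_of_forall_notMem fun t ht => ?_
  have ht' : Multiset.countP _ _ = 2 := ht
  rcases countP_multipliers hv t with h | h <;> rw [h] at ht' <;> omega

/-! ### Bloch solutions -/

/-- The solution with a given initial value. -/
lemma exists_solves {v : Fin 2 → ℝ → ℂ} (hv : IsPotential v) (z : ℂ) (c : Fin 3 → ℂ) :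
    ∃ u : ℝ → C3, Solves v u (fun x => z • u x) ∧ (u 0).ofLp = c ∧
      (u 1).ofLp = (monodromy v z).mulVec c := by
  have hy := isFundamentalSolution_fundamentalSolution hv z
  refine ⟨fun x => c 0 • column (fundamentalSolution v z) 0 x
    + c 1 • column (fundamentalSolution v z) 1 x + c 2 • column (fundamentalSolution v z) 2 x,
    ?_, ?_, ?_⟩
  · refine ((((hy.2 0).const_smul (c 0)).add ((hy.2 1).const_smul (c 1))).add
      ((hy.2 2).const_smul (c 2))).congr (Eventually.of_forall fun x => ?_)
    simp only [smul_add, smul_comm z]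
  · ext i
    fin_cases i <;> simp [column, hy.1]
  · ext i
    simp [column, monodromy, Matrix.mulVec, dotProduct, Fin.sum_univ_three, mul_comm]

/-- The count of unimodular multipliers is odd, hence positive. An eigenvector of `ψ(t)` for such a
`τ` starts a solution with `u(x + 1) = τ u(x)`, by uniqueness. -/
lemma exists_bloch {v : Fin 2 → ℝ → ℂ} (hv : IsPotential v) (t : ℝ) :
    ∃ u : ℝ → C3, Solves v u (fun x => (t : ℂ) • u x) ∧ u 0 ≠ 0 ∧ ∀ x, ‖u (x + 1)‖ = ‖u x‖ := by
  classical
  obtain ⟨τ, hτ, hn⟩ : ∃ τ ∈ multipliers v t, ‖τ‖ = 1 := by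
    rw [← Multiset.countP_pos]
    rcases countP_multipliers hv t with h | h <;> rw [h] <;> norm_num
  have hroot : D v τ t = 0 := by
    have := (Polynomial.mem_roots'.1 hτ).2
    rw [Polynomial.IsRoot, eval_charpoly_monodromy, neg_eq_zero] at this
    exact this
  obtain ⟨c, hc0, hc⟩ := Matrix.exists_mulVec_eq_zero_iff.2 hroot
  rw [Matrix.sub_mulVec, Matrix.smul_mulVec, Matrix.one_mulVec, sub_eq_zero] at hc
  obtain ⟨u, hu, h0, h1⟩ := exists_solves hv t c
  refine ⟨u, hu, fun h => hc0 (by rw [← h0, h]; rfl), fun x => ?_⟩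
  have h2 : Solves v (fun x => τ • u x) (fun x => (t : ℂ) • τ • u x) :=
    (hu.const_smul τ).congr (Eventually.of_forall fun x => smul_comm _ _ _)
  have h3 := (hu.comp_add_one hv).eq_of_eq hv h2 (by
    ext i
    simp only [zero_add]
    rw [h1, hc, PiLp.smul_apply, h0]
    rfl) x
  rw [h3, norm_smul, hn, one_mul]

/-! ### A uniform Riemann–Lebesgue lemma -/

/-- The oscillatory kernel is dominated by `e^{|Im z| (x - s)}`. -/
lemma norm_exp_kernel_le (z : ℂ) {s t x : ℝ} (hst : s ≤ t) (htx : t ≤ x) :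
    ‖Complex.exp (-Complex.I * z * (x + s)) * Complex.exp (2 * Complex.I * z * t)‖
      ≤ Real.exp (|z.im| * (x - s)) := by
  rw [← Complex.exp_add, Complex.norm_exp]
  refine Real.exp_le_exp.2 ?_
  have : (-Complex.I * z * (x + s) + 2 * Complex.I * z * t).re = z.im * (x + s - 2 * t) := by
    simp
    ring
  rw [this]
  refine (le_abs_self _).trans ?_
  rw [abs_mul]
  exact mul_le_mul_of_nonneg_left (abs_le.2 ⟨by linarith, by linarith⟩) (abs_nonneg _)

lemma exists_contDiff_integral_norm_sub_lt {f : ℝ → ℂ} (hf : IntervalIntegrable f volume 0 1)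
    {ε : ℝ} (hε : 0 < ε) :
    ∃ g : ℝ → ℂ, ContDiff ℝ 1 g ∧ IntervalIntegrable (fun t => ‖f t - g t‖) volume 0 1 ∧
      ∫ t in (0 : ℝ)..1, ‖f t - g t‖ < ε := by
  rw [intervalIntegrable_iff_integrableOn_Ioc_of_le zero_le_one] at hf
  have hF : MemLp ((Set.Ioc (0 : ℝ) 1).indicator f) 1 volume :=
    memLp_one_iff_integrable.2 (hf.integrable_indicator measurableSet_Ioc)
  obtain ⟨g, hg⟩ := (SchwartzMap.denseRange_toLpCLM (F := ℂ) (E := ℝ) (p := 1)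
    (μ := volume) ENNReal.one_ne_top).exists_dist_lt hF.toLp hε
  have hgi : Integrable (fun t => g t) volume := g.integrable
  have hi : Integrable (fun t => ‖(Set.Ioc (0 : ℝ) 1).indicator f t - g t‖) volume :=
    ((hf.integrable_indicator measurableSet_Ioc).sub hgi).norm
  have heq : Set.EqOn (fun t => ‖(Set.Ioc (0 : ℝ) 1).indicator f t - g t‖)
      (fun t => ‖f t - g t‖) (Set.Ioc 0 1) := fun t ht => by
    simp only [Set.indicator_of_mem ht]
  have h_le : IntervalIntegrable (fun t => ‖f t - g t‖) volume 0 1 := by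
    rw [intervalIntegrable_iff_integrableOn_Ioc_of_le zero_le_one]
    exact hi.integrableOn.congr_fun heq measurableSet_Ioc
  refine ⟨g, g.smooth 1, h_le, ?_⟩
  rw [intervalIntegral.integral_of_le zero_le_one, ← setIntegral_congr_fun measurableSet_Ioc heq]
  refine (setIntegral_le_integral hi (ae_of_all _ fun t => norm_nonneg _)).trans_lt ?_
  rw [dist_eq_norm, L1.norm_eq_integral_norm] at hg
  refine lt_of_eq_of_lt (integral_congr_ae ?_) hg
  filter_upwards [Lp.coeFn_sub hF.toLp (SchwartzMap.toLpCLM ℝ ℂ 1 volume g), hF.coeFn_toLp,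
    SchwartzMap.coeFn_toLp g 1 volume] with t h1 h2 h3
  rw [h1, Pi.sub_apply, h2]
  congr 2
  exact h3.symm

/-- One integration by parts gains the factor `1/(2iz)`. The two boundary terms and the remaining
integral are each bounded through `norm_exp_kernel_le`, which gives the constant `K + K + L`. -/
lemma norm_kernel_integral_le_of_contDiff {g : ℝ → ℂ} (hg : ContDiff ℝ 1 g) :
    ∃ C : ℝ, 0 ≤ C ∧ ∀ z : ℂ, z ≠ 0 → ∀ s x : ℝ, 0 ≤ s → s ≤ x → x ≤ 1 →
      ‖Complex.exp (-Complex.I * z * (x + s))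
        * ∫ t in s..x, Complex.exp (2 * Complex.I * z * t) * g t‖
        ≤ C / ‖z‖ * Real.exp (|z.im| * (x - s)) := by
  obtain ⟨K, hK⟩ := (isCompact_Icc (a := (0 : ℝ)) (b := 1)).exists_bound_of_continuousOn
    hg.continuous.continuousOn
  obtain ⟨L, hL⟩ := (isCompact_Icc (a := (0 : ℝ)) (b := 1)).exists_bound_of_continuousOn
    (hg.continuous_deriv le_rfl).continuousOn
  have hK0 : 0 ≤ K := (norm_nonneg _).trans (hK 0 (by simp))
  have hL0 : 0 ≤ L := (norm_nonneg _).trans (hL 0 (by simp))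
  refine ⟨K + K + L, by positivity, fun z hz s x hs hsx hx => ?_⟩
  have hpos := Real.exp_pos (|z.im| * (x - s))
  have hz2 : 2 * Complex.I * z ≠ 0 := by simp [hz]
  have hparts : 2 * Complex.I * z * ∫ t in s..x, Complex.exp (2 * Complex.I * z * t) * g t
      = Complex.exp (2 * Complex.I * z * x) * g x - Complex.exp (2 * Complex.I * z * s) * g s
        - ∫ t in s..x, Complex.exp (2 * Complex.I * z * t) * deriv g t := by
    have hce : Continuous fun t : ℝ => Complex.exp (2 * Complex.I * z * t) := by fun_prop
    rw [← ((HasACDeriv.exp (2 * Complex.I * z)).mul (HasACDeriv.of_contDiff hg)).integral_eq_sub,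
      ← intervalIntegral.integral_const_mul, ← intervalIntegral.integral_sub]
    · refine intervalIntegral.integral_congr fun t _ => ?_
      ring
    · exact (((continuous_const.mul hce).mul hg.continuous).add
        (hce.mul (hg.continuous_deriv le_rfl))).intervalIntegrable _ _
    · exact (hce.mul (hg.continuous_deriv le_rfl)).intervalIntegrable _ _
  have hb1 : ‖Complex.exp (-Complex.I * z * (x + s)) * (Complex.exp (2 * Complex.I * z * x) * g x)‖
      ≤ K * Real.exp (|z.im| * (x - s)) := by
    rw [← mul_assoc, norm_mul, mul_comm K]
    exact mul_le_mul (norm_exp_kernel_le z hsx le_rfl) (hK x ⟨by linarith, hx⟩) (norm_nonneg _)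
      hpos.le
  have hb2 : ‖Complex.exp (-Complex.I * z * (x + s)) * (Complex.exp (2 * Complex.I * z * s) * g s)‖
      ≤ K * Real.exp (|z.im| * (x - s)) := by
    rw [← mul_assoc, norm_mul, mul_comm K]
    exact mul_le_mul (norm_exp_kernel_le z le_rfl hsx) (hK s ⟨hs, by linarith⟩) (norm_nonneg _)
      hpos.le
  have hb3 : ‖Complex.exp (-Complex.I * z * (x + s))
      * ∫ t in s..x, Complex.exp (2 * Complex.I * z * t) * deriv g t‖
      ≤ L * Real.exp (|z.im| * (x - s)) := by
    rw [← intervalIntegral.integral_const_mul]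
    refine (intervalIntegral.norm_integral_le_of_norm_le_const (C := L *
      Real.exp (|z.im| * (x - s))) fun t ht => ?_).trans ?_
    · rw [Set.uIoc_of_le hsx] at ht
      rw [← mul_assoc, norm_mul, mul_comm L]
      exact mul_le_mul (norm_exp_kernel_le z ht.1.le ht.2)
        (hL t ⟨by linarith [ht.1], by linarith [ht.2]⟩) (norm_nonneg _) hpos.le
    · refine mul_le_of_le_one_right (by positivity) ?_
      rw [abs_of_nonneg (by linarith)]
      linarith
  have hfin : ‖2 * Complex.I * z * (Complex.exp (-Complex.I * z * (x + s))
      * ∫ t in s..x, Complex.exp (2 * Complex.I * z * t) * g t)‖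
      ≤ (K + K + L) * Real.exp (|z.im| * (x - s)) := by
    have : 2 * Complex.I * z * (Complex.exp (-Complex.I * z * (x + s))
        * ∫ t in s..x, Complex.exp (2 * Complex.I * z * t) * g t)
        = Complex.exp (-Complex.I * z * (x + s)) * (Complex.exp (2 * Complex.I * z * x) * g x)
          - Complex.exp (-Complex.I * z * (x + s)) * (Complex.exp (2 * Complex.I * z * s) * g s)
          - Complex.exp (-Complex.I * z * (x + s))
            * ∫ t in s..x, Complex.exp (2 * Complex.I * z * t) * deriv g t := by
      rw [← mul_sub, ← mul_sub, ← hparts]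
      ring
    rw [this]
    refine (norm_sub_le _ _).trans ((add_le_add_left (norm_sub_le _ _) _).trans ?_)
    linarith
  rw [norm_mul] at hfin
  have hn : ‖2 * Complex.I * z‖ = 2 * ‖z‖ := by simp
  rw [hn] at hfin
  have hzp : 0 < ‖z‖ := norm_pos_iff.2 hz
  rw [div_mul_eq_mul_div, le_div_iff₀ hzp]
  nlinarith [norm_nonneg (Complex.exp (-Complex.I * z * (x + s))
      * ∫ t in s..x, Complex.exp (2 * Complex.I * z * t) * g t)]

/-- Uniform Riemann–Lebesgue lemma: the oscillatory integrals of an integrable function are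
uniformly small as `|z| → ∞`, relative to `e^{|Im z| (x - s)}`. -/
lemma eventually_norm_kernel_integral_le {f : ℝ → ℂ} (hf : IntervalIntegrable f volume 0 1)
    {ε : ℝ} (hε : 0 < ε) :
    ∀ᶠ z : ℂ in Bornology.cobounded ℂ, ∀ s x : ℝ, 0 ≤ s → s ≤ x → x ≤ 1 →
      ‖Complex.exp (-Complex.I * z * (x + s))
        * ∫ t in s..x, Complex.exp (2 * Complex.I * z * t) * f t‖
        ≤ ε * Real.exp (|z.im| * (x - s)) := by
  -- Half of `ε` pays for the `L¹` error `f - g`, uniformly in `z`; the other half pays for `C/‖z‖`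
  -- once `‖z‖` is large.
  obtain ⟨g, hg, hfgi, hfg⟩ := exists_contDiff_integral_norm_sub_lt hf (half_pos hε)
  obtain ⟨C, hC0, hC⟩ := norm_kernel_integral_le_of_contDiff hg
  have hlarge : ∀ᶠ z : ℂ in Bornology.cobounded ℂ, 2 * C / ε + 1 ≤ ‖z‖ :=
    tendsto_norm_cobounded_atTop.eventually (eventually_ge_atTop _)
  filter_upwards [hlarge] with z hz s x hs hsx hx
  have hzp : 0 < ‖z‖ := lt_of_lt_of_le (by positivity) hz
  have hpos := Real.exp_pos (|z.im| * (x - s))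
  have hce : Continuous fun t : ℝ => Complex.exp (2 * Complex.I * z * t) := by fun_prop
  have hsub : Set.uIcc s x ⊆ Set.uIcc (0 : ℝ) 1 := by
    rw [Set.uIcc_of_le hsx, Set.uIcc_of_le zero_le_one]
    exact Set.Icc_subset_Icc hs hx
  have hfi : IntervalIntegrable f volume s x := hf.mono_set hsub
  have hgi : IntervalIntegrable g volume s x := hg.continuous.intervalIntegrable _ _
  have hsplit : ∫ t in s..x, Complex.exp (2 * Complex.I * z * t) * f t
      = (∫ t in s..x, Complex.exp (2 * Complex.I * z * t) * (f t - g t))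
        + ∫ t in s..x, Complex.exp (2 * Complex.I * z * t) * g t := by
    rw [← intervalIntegral.integral_add]
    · refine intervalIntegral.integral_congr fun t _ => ?_
      ring
    · exact (hfi.sub hgi).continuousOn_mul hce.continuousOn
    · exact hgi.continuousOn_mul hce.continuousOn
  have h1 : ‖Complex.exp (-Complex.I * z * (x + s))
      * ∫ t in s..x, Complex.exp (2 * Complex.I * z * t) * (f t - g t)‖
      ≤ ε / 2 * Real.exp (|z.im| * (x - s)) := by
    rw [← intervalIntegral.integral_const_mul]
    have h2 : ‖∫ t in s..x, Complex.exp (-Complex.I * z * (x + s))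
        * (Complex.exp (2 * Complex.I * z * t) * (f t - g t))‖
        ≤ ∫ t in s..x, Real.exp (|z.im| * (x - s)) * ‖f t - g t‖ := by
      refine intervalIntegral.norm_integral_le_of_norm_le hsx (ae_of_all _ fun t ht => ?_)
        ((hfi.sub hgi).norm.const_mul _)
      rw [← mul_assoc, norm_mul]
      exact mul_le_mul_of_nonneg_right (norm_exp_kernel_le z ht.1.le ht.2) (norm_nonneg _)
    refine h2.trans ?_
    rw [intervalIntegral.integral_const_mul, mul_comm]
    refine mul_le_mul_of_nonneg_right ?_ hpos.le
    refine (intervalIntegral.integral_mono_interval hs hsx hx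
      (ae_of_all _ fun t => norm_nonneg _) hfgi).trans hfg.le
  have h3 := hC z (norm_pos_iff.1 hzp) s x hs hsx hx
  have h4 : C / ‖z‖ ≤ ε / 2 := by
    rw [div_le_iff₀ hzp]
    have : 2 * C / ε ≤ ‖z‖ := by linarith
    rw [div_le_iff₀ hε] at this
    linarith
  rw [hsplit, mul_add]
  refine (norm_add_le _ _).trans ?_
  nlinarith

/-! ### Asymptotics of the trace of the monodromy matrix -/

/-- The oscillatory integrals of the potential are at most `ρ` relative to `e^{|Im z| (x - s)}`. -/
def KernelBound (v : Fin 2 → ℝ → ℂ) (z : ℂ) (ρ : ℝ) : Prop :=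
  ∀ k : Fin 2, ∀ s x : ℝ, 0 ≤ s → s ≤ x → x ≤ 1 →
    ‖Complex.exp (-Complex.I * z * (x + s))
      * ∫ t in s..x, Complex.exp (2 * Complex.I * z * t) * star (v k t)‖
      ≤ ρ * Real.exp (|z.im| * (x - s))

/-- The `L¹` norm of the potential over a period. -/
noncomputable def l1norm (v : Fin 2 → ℝ → ℂ) : ℝ := ∫ t in (0 : ℝ)..1, (‖v 0 t‖ + ‖v 1 t‖)

lemma l1norm_nonneg (v : Fin 2 → ℝ → ℂ) : 0 ≤ l1norm v :=
  intervalIntegral.integral_nonneg zero_le_one fun t _ => by positivity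

variable {v : Fin 2 → ℝ → ℂ}

lemma IsPotential.intervalIntegrable_norm_add (hv : IsPotential v) (a b : ℝ) :
    IntervalIntegrable (fun t => ‖v 0 t‖ + ‖v 1 t‖) volume a b :=
  (hv.intervalIntegrable 0 a b).norm.add (hv.intervalIntegrable 1 a b).norm

/-- The first component after eliminating the other two. -/
lemma first_component_sub_eq (hv : IsPotential v) {z : ℂ} {u : ℝ → C3}
    (hu : Solves v u (fun x => z • u x)) (x : ℝ) :
    u x 0 - Complex.exp (-Complex.I * z * x) * u 0 0
      = Complex.I * (
          (Complex.exp (-Complex.I * z * (x + (0 : ℝ)))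
            * ∫ t in (0 : ℝ)..x, Complex.exp (2 * Complex.I * z * t) * star (v 0 t)) * u 0 1
          + (Complex.exp (-Complex.I * z * (x + (0 : ℝ)))
            * ∫ t in (0 : ℝ)..x, Complex.exp (2 * Complex.I * z * t) * star (v 1 t)) * u 0 2)
        + ∫ s in (0 : ℝ)..x,
          ((Complex.exp (-Complex.I * z * (x + s))
            * ∫ t in s..x, Complex.exp (2 * Complex.I * z * t) * star (v 0 t)) * (v 0 s * u s 0)
          + (Complex.exp (-Complex.I * z * (x + s))
            * ∫ t in s..x, Complex.exp (2 * Complex.I * z * t) * star (v 1 t))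
              * (v 1 s * u s 0)) := by
  obtain ⟨h0, h1, h2⟩ := solves_iff.1 hu
  have hqi : ∀ (k : Fin 2) (a b : ℝ), IntervalIntegrable
      (fun t : ℝ => Complex.exp (2 * Complex.I * z * t) * star (v k t)) volume a b := fun k a b =>
    (hv.intervalIntegrable_star k a b).continuousOn_mul (by fun_prop)
  have hq : ∀ k : Fin 2, HasACDeriv
      (fun s => ∫ t in s..x, Complex.exp (2 * Complex.I * z * t) * star (v k t))
      (fun s => -(Complex.exp (2 * Complex.I * z * s) * star (v k s))) := by
    intro k
    refine (((HasACDeriv.const (∫ t in (0 : ℝ)..x, Complex.exp (2 * Complex.I * z * t)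
      * star (v k t))).sub (HasACDeriv.integral (hqi k))).congr_fun fun s => ?_).congr
      (Eventually.of_forall fun s => by simp)
    exact intervalIntegral.integral_interval_sub_left (hqi k _ _) (hqi k _ _)
  -- With `q_k(s) = ∫ₛˣ e^{2izt} v̄_k`, the function is `e^{izs}u₀ + i e^{-izs}(q₀u₁ + q₁u₂)`. The
  -- terms in `u₁` and `u₂` cancel in its derivative, which eliminates these components without a
  -- double integral. Since `q_k(x) = 0`, its value at `x` involves only `u₀`.
  have hG := ((HasACDeriv.exp (Complex.I * z)).mul h0).add
    ((((hq 0).mul ((HasACDeriv.exp (-Complex.I * z)).mul h1)).add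
      ((hq 1).mul ((HasACDeriv.exp (-Complex.I * z)).mul h2))).const_mul Complex.I)
  have hE : ∀ s : ℝ, Complex.exp (2 * Complex.I * z * s) * Complex.exp (-Complex.I * z * s)
      = Complex.exp (Complex.I * z * s) := fun s => by
    rw [← Complex.exp_add]
    ring_nf
  have hEx : Complex.exp (-Complex.I * z * x) * Complex.exp (Complex.I * z * x) = 1 := by
    rw [← Complex.exp_add]
    ring_nf
    simp
  have hI := Complex.I_mul_I
  have hadd : ∀ s : ℝ, Complex.exp (-Complex.I * z * (x + s))
      = Complex.exp (-Complex.I * z * x) * Complex.exp (-Complex.I * z * s) := fun s => by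
    rw [← Complex.exp_add]
    ring_nf
  have key := (hG.congr (n := fun s =>
      Complex.exp (-Complex.I * z * s)
        * ((∫ t in s..x, Complex.exp (2 * Complex.I * z * t) * star (v 0 t)) * (v 0 s * u s 0)
          + (∫ t in s..x, Complex.exp (2 * Complex.I * z * t) * star (v 1 t)) * (v 1 s * u s 0)))
      (Eventually.of_forall fun s => by
        simp only [PiLp.smul_apply, smul_eq_mul]
        have hEs := hE s
        generalize (∫ t in s..x, Complex.exp (2 * Complex.I * z * t) * star (v 0 t)) = q0
        generalize (∫ t in s..x, Complex.exp (2 * Complex.I * z * t) * star (v 1 t)) = q1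
        linear_combination (-Complex.I * (star (v 0 s) * u s 1 + star (v 1 s) * u s 2)) * hEs
          - Complex.exp (-Complex.I * z * s)
            * (q0 * (v 0 s * u s 0) + q1 * (v 1 s * u s 0)) * hI)).integral_eq_sub 0 x
  have key2 := congrArg (fun w => Complex.exp (-Complex.I * z * x) * w) key
  simp only at key2
  rw [← intervalIntegral.integral_const_mul] at key2
  simp only [hadd]
  have hfun : ∀ s : ℝ, Complex.exp (-Complex.I * z * x) * (Complex.exp (-Complex.I * z * s)
        * ((∫ t in s..x, Complex.exp (2 * Complex.I * z * t) * star (v 0 t)) * (v 0 s * u s 0)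
          + (∫ t in s..x, Complex.exp (2 * Complex.I * z * t) * star (v 1 t)) * (v 1 s * u s 0)))
      = (Complex.exp (-Complex.I * z * x) * Complex.exp (-Complex.I * z * s)
            * ∫ t in s..x, Complex.exp (2 * Complex.I * z * t) * star (v 0 t)) * (v 0 s * u s 0)
          + (Complex.exp (-Complex.I * z * x) * Complex.exp (-Complex.I * z * s)
            * ∫ t in s..x, Complex.exp (2 * Complex.I * z * t) * star (v 1 t))
              * (v 1 s * u s 0) := fun s => by ring
  simp only [hfun] at key2
  rw [key2]
  simp only [intervalIntegral.integral_same, Complex.ofReal_zero, mul_zero, Complex.exp_zero]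
  linear_combination (-u x 0) * hEx

/-- The kernel weight `e^{|Im z|(x-s)}` and the assumed growth `e^{|Im z|s}` multiply to `e^{|Im
z|x}`, independent of `s`, so only the `L¹` norm of `v` remains to be integrated. -/
lemma norm_first_component_sub_le (hv : IsPotential v) {z : ℂ} {ρ : ℝ} (hρ : 0 ≤ ρ)
    (hk : KernelBound v z ρ) {u : ℝ → C3} (hu : Solves v u (fun x => z • u x)) {M : ℝ}
    (hM0 : 0 ≤ M) (hM : ∀ s ∈ Set.Icc (0 : ℝ) 1, ‖u s 0‖ ≤ M * Real.exp (|z.im| * s))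
    {x : ℝ} (hx : x ∈ Set.Icc (0 : ℝ) 1) :
    ‖u x 0 - Complex.exp (-Complex.I * z * x) * u 0 0‖
      ≤ ρ * (‖u 0 1‖ + ‖u 0 2‖ + l1norm v * M) * Real.exp (|z.im| * x) := by
  have hpos := Real.exp_pos (|z.im| * x)
  rw [first_component_sub_eq hv hu x]
  have h_le : ‖∫ s in (0 : ℝ)..x,
      ((Complex.exp (-Complex.I * z * (x + s))
        * ∫ t in s..x, Complex.exp (2 * Complex.I * z * t) * star (v 0 t)) * (v 0 s * u s 0)
      + (Complex.exp (-Complex.I * z * (x + s))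
        * ∫ t in s..x, Complex.exp (2 * Complex.I * z * t) * star (v 1 t)) * (v 1 s * u s 0))‖
      ≤ ∫ s in (0 : ℝ)..x, ρ * M * Real.exp (|z.im| * x) * (‖v 0 s‖ + ‖v 1 s‖) := by
    refine intervalIntegral.norm_integral_le_of_norm_le hx.1 (ae_of_all _ fun s hs => ?_)
      ((hv.intervalIntegrable_norm_add 0 x).const_mul _)
    have hus := hM s ⟨hs.1.le, hs.2.trans hx.2⟩
    have hexp : Real.exp (|z.im| * x) = Real.exp (|z.im| * (x - s)) * Real.exp (|z.im| * s) := by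
      rw [← Real.exp_add]
      ring_nf
    have hterm : ∀ k : Fin 2, ‖(Complex.exp (-Complex.I * z * (x + s))
        * ∫ t in s..x, Complex.exp (2 * Complex.I * z * t) * star (v k t)) * (v k s * u s 0)‖
        ≤ ρ * M * Real.exp (|z.im| * x) * ‖v k s‖ := by
      intro k
      rw [norm_mul, norm_mul (v k s)]
      calc _ ≤ (ρ * Real.exp (|z.im| * (x - s))) * (‖v k s‖ * (M * Real.exp (|z.im| * s))) :=
            mul_le_mul (hk k s x hs.1.le hs.2 hx.2)
              (mul_le_mul_of_nonneg_left hus (norm_nonneg _)) (by positivity) (by positivity)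
        _ = _ := by rw [hexp]; ring
    refine (norm_add_le _ _).trans ((add_le_add (hterm 0) (hterm 1)).trans (le_of_eq ?_))
    ring
  have h_le' : ∫ s in (0 : ℝ)..x, ρ * M * Real.exp (|z.im| * x) * (‖v 0 s‖ + ‖v 1 s‖)
      ≤ ρ * M * Real.exp (|z.im| * x) * l1norm v := by
    rw [intervalIntegral.integral_const_mul]
    refine mul_le_mul_of_nonneg_left ?_ (by positivity)
    exact intervalIntegral.integral_mono_interval le_rfl hx.1 hx.2
      (ae_of_all _ fun t => add_nonneg (norm_nonneg _) (norm_nonneg _))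
      (hv.intervalIntegrable_norm_add 0 1)
  have hb : ∀ (k : Fin 2) (w : ℂ), ‖(Complex.exp (-Complex.I * z * (x + (0 : ℝ)))
      * ∫ t in (0 : ℝ)..x, Complex.exp (2 * Complex.I * z * t) * star (v k t)) * w‖
      ≤ ρ * Real.exp (|z.im| * x) * ‖w‖ := by
    intro k w
    rw [norm_mul]
    refine mul_le_mul_of_nonneg_right ?_ (norm_nonneg _)
    simpa using hk k 0 x le_rfl hx.1 hx.2
  refine (norm_add_le _ _).trans ((add_le_add (?_ : _ ≤ ρ * Real.exp (|z.im| * x) * ‖u 0 1‖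
    + ρ * Real.exp (|z.im| * x) * ‖u 0 2‖) (h_le.trans h_le')).trans (le_of_eq (by ring)))
  rw [norm_mul, Complex.norm_I, one_mul]
  exact (norm_add_le _ _).trans (add_le_add (hb 0 _) (hb 1 _))

/-- Bootstrap: the maximum `M` of the weighted modulus is attained, and the previous estimate at
that point reads `M ≤ data + M/2`, where the last term is absorbed. -/
lemma norm_first_component_le (hv : IsPotential v) {z : ℂ} {ρ : ℝ} (hρ : 0 ≤ ρ)
    (hρN : ρ * l1norm v ≤ 1 / 2) (hk : KernelBound v z ρ) {u : ℝ → C3}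
    (hu : Solves v u (fun x => z • u x)) {x : ℝ} (hx : x ∈ Set.Icc (0 : ℝ) 1) :
    ‖u x 0‖ ≤ 2 * (‖u 0 0‖ + ρ * (‖u 0 1‖ + ‖u 0 2‖)) * Real.exp (|z.im| * x) := by
  have hc : Continuous fun s => ‖u s 0‖ / Real.exp (|z.im| * s) := by
    obtain ⟨m, hm⟩ := hu.hasACDeriv_coord 0
    exact hm.continuous.norm.div (by fun_prop) fun s => (Real.exp_pos _).ne'
  obtain ⟨y, hy, hmax⟩ := (isCompact_Icc (a := (0 : ℝ)) (b := 1)).exists_isMaxOn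
    (by simp) hc.continuousOn
  set M := ‖u y 0‖ / Real.exp (|z.im| * y) with hMdef
  have hM0 : 0 ≤ M := by positivity
  have hM : ∀ s ∈ Set.Icc (0 : ℝ) 1, ‖u s 0‖ ≤ M * Real.exp (|z.im| * s) := by
    intro s hs
    have := hmax hs
    rwa [← div_le_iff₀ (Real.exp_pos _)]
  have h1 := norm_first_component_sub_le hv hρ hk hu hM0 hM hy
  have hfree : ‖Complex.exp (-Complex.I * z * y) * u 0 0‖ ≤ Real.exp (|z.im| * y) * ‖u 0 0‖ := by
    rw [norm_mul, Complex.norm_exp]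
    refine mul_le_mul_of_nonneg_right (Real.exp_le_exp.2 ?_) (norm_nonneg _)
    have : (-Complex.I * z * y).re = z.im * y := by simp
    rw [this]
    exact mul_le_mul_of_nonneg_right (le_abs_self _) hy.1
  have hle : M ≤ ‖u 0 0‖ + ρ * (‖u 0 1‖ + ‖u 0 2‖ + l1norm v * M) := by
    rw [hMdef, div_le_iff₀ (Real.exp_pos _), ← hMdef]
    have h2 : ‖u y 0‖ ≤ ‖u y 0 - Complex.exp (-Complex.I * z * y) * u 0 0‖
        + ‖Complex.exp (-Complex.I * z * y) * u 0 0‖ := by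
      simpa using norm_add_le (u y 0 - Complex.exp (-Complex.I * z * y) * u 0 0)
        (Complex.exp (-Complex.I * z * y) * u 0 0)
    linarith
  have hMle : M ≤ 2 * (‖u 0 0‖ + ρ * (‖u 0 1‖ + ‖u 0 2‖)) := by
    have : ρ * l1norm v * M ≤ 1 / 2 * M := mul_le_mul_of_nonneg_right hρN hM0
    nlinarith
  exact (hM x hx).trans (mul_le_mul_of_nonneg_right hMle (Real.exp_pos _).le)

lemma norm_exp_mul_le (z : ℂ) {s : ℝ} (hs : s ≤ 1) :
    ‖Complex.exp (Complex.I * z) * Complex.exp (-Complex.I * z * s)‖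
      ≤ Real.exp (|z.im| * (1 - s)) := by
  rw [← Complex.exp_add, Complex.norm_exp]
  refine Real.exp_le_exp.2 ?_
  have : (Complex.I * z + -Complex.I * z * s).re = -z.im * (1 - s) := by
    simp
    ring
  rw [this]
  exact mul_le_mul_of_nonneg_right (neg_le_abs _) (by linarith)

/-- The other components are controlled by the first one. -/
lemma norm_component_sub_le (hv : IsPotential v) {z : ℂ} {p : ℝ → ℂ} {w : ℝ → ℂ} (k : Fin 2)
    (hw : HasACDeriv w (fun x => Complex.I * (z * w x - v k x * p x))) {M : ℝ}
    (hM : ∀ s ∈ Set.Icc (0 : ℝ) 1, ‖p s‖ ≤ M * Real.exp (|z.im| * s)) :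
    ‖w 1 - Complex.exp (Complex.I * z) * w 0‖ ≤ l1norm v * M * Real.exp |z.im| := by
  have h1 := (((HasACDeriv.exp (-Complex.I * z)).mul hw).congr
    (n := fun s => Complex.exp (-Complex.I * z * s) * (-Complex.I * (v k s * p s)))
    (Eventually.of_forall fun s => by ring)).integral_eq_sub 0 1
  have h2 : w 1 - Complex.exp (Complex.I * z) * w 0
      = ∫ s in (0 : ℝ)..1, Complex.exp (Complex.I * z)
        * (Complex.exp (-Complex.I * z * s) * (-Complex.I * (v k s * p s))) := by
    rw [intervalIntegral.integral_const_mul, h1]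
    have := exp_neg_I_mul_mul_exp z
    simp only [Complex.ofReal_one, mul_one, Complex.ofReal_zero, mul_zero, Complex.exp_zero,
      one_mul]
    linear_combination (-w 1) * this
  rw [h2]
  refine (intervalIntegral.norm_integral_le_of_norm_le (g := fun s =>
    M * Real.exp |z.im| * (‖v 0 s‖ + ‖v 1 s‖)) zero_le_one (ae_of_all _ fun s hs => ?_)
    ((hv.intervalIntegrable_norm_add 0 1).const_mul _)).trans (le_of_eq ?_)
  · have hexp : Real.exp |z.im| = Real.exp (|z.im| * (1 - s)) * Real.exp (|z.im| * s) := by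
      rw [← Real.exp_add]
      ring_nf
    have hvk : ‖v k s‖ ≤ ‖v 0 s‖ + ‖v 1 s‖ := by
      fin_cases k
      exacts [le_add_of_nonneg_right (norm_nonneg _), le_add_of_nonneg_left (norm_nonneg _)]
    rw [← mul_assoc, norm_mul, norm_mul (-Complex.I), norm_neg, Complex.norm_I, one_mul,
      norm_mul (v k s)]
    calc _ ≤ Real.exp (|z.im| * (1 - s)) * ((‖v 0 s‖ + ‖v 1 s‖) * (M * Real.exp (|z.im| * s))) :=
          mul_le_mul (norm_exp_mul_le z hs.2) (mul_le_mul hvk (hM s ⟨hs.1.le, hs.2⟩)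
            (norm_nonneg _) (by positivity)) (by positivity) (by positivity)
      _ = _ := by rw [hexp]; ring
  · rw [intervalIntegral.integral_const_mul, l1norm]
    ring

/-- Each diagonal entry contributes `2ρ` times the `L¹` norm. In the first column the growth
constant is `2` and the error carries the factor `ρ`. In the other two the first component starts at
zero, so its growth constant is already `2ρ`. -/
lemma norm_T_sub_le (hv : IsPotential v) {z : ℂ} {ρ : ℝ} (hρ : 0 ≤ ρ)
    (hρN : ρ * l1norm v ≤ 1 / 2) (hk : KernelBound v z ρ) :
    ‖T v z - (2 * Complex.exp (Complex.I * z) + Complex.exp (-Complex.I * z))‖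
      ≤ 6 * ρ * l1norm v * Real.exp |z.im| := by
  have hy := isFundamentalSolution_fundamentalSolution hv z
  have hval : ∀ i j : Fin 3, column (fundamentalSolution v z) j 0 i
      = (1 : Matrix (Fin 3) (Fin 3) ℂ) i j := fun i j => by simp [column, hy.1]
  have hmon : ∀ i j : Fin 3, column (fundamentalSolution v z) j 1 i = monodromy v z i j :=
    fun i j => rfl
  have h0 : ‖monodromy v z 0 0 - Complex.exp (-Complex.I * z)‖
      ≤ 2 * ρ * l1norm v * Real.exp |z.im| := by
    have hM := fun s hs => norm_first_component_le hv hρ hρN hk (hy.2 0) (x := s) hs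
    have h := norm_first_component_sub_le hv hρ hk (hy.2 0) (by positivity) hM
      (x := 1) (by simp)
    simp only [hval, hmon, Matrix.one_apply, Fin.reduceEq, if_true, if_false] at h
    norm_num at h
    norm_num
    linarith
  have h1 : ‖monodromy v z 1 1 - Complex.exp (Complex.I * z)‖
      ≤ 2 * ρ * l1norm v * Real.exp |z.im| := by
    have hM := fun s hs => norm_first_component_le hv hρ hρN hk (hy.2 1) (x := s) hs
    have h := norm_component_sub_le hv 0 (solves_iff.1 (hy.2 1)).2.1 hM
    simp only [hval, hmon, Matrix.one_apply, Fin.reduceEq, if_true, if_false] at h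
    norm_num at h
    linarith
  have h2 : ‖monodromy v z 2 2 - Complex.exp (Complex.I * z)‖
      ≤ 2 * ρ * l1norm v * Real.exp |z.im| := by
    have hM := fun s hs => norm_first_component_le hv hρ hρN hk (hy.2 2) (x := s) hs
    have h := norm_component_sub_le hv 1 (solves_iff.1 (hy.2 2)).2.2 hM
    simp only [hval, hmon, Matrix.one_apply, Fin.reduceEq, if_true, if_false] at h
    norm_num at h
    linarith
  have hT : T v z - (2 * Complex.exp (Complex.I * z) + Complex.exp (-Complex.I * z))
      = (monodromy v z 0 0 - Complex.exp (-Complex.I * z))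
        + (monodromy v z 1 1 - Complex.exp (Complex.I * z))
        + (monodromy v z 2 2 - Complex.exp (Complex.I * z)) := by
    rw [T, Matrix.trace_fin_three]
    ring
  rw [hT]
  refine (norm_add₃_le).trans ?_
  linarith

/-- `T(z) = 2e^{iz} + e^{-iz} + o(e^{|Im z|})` as `|z| → ∞`. -/
lemma eventually_norm_T_sub_le (hv : IsPotential v) {ε : ℝ} (hε : 0 < ε) :
    ∀ᶠ z : ℂ in Bornology.cobounded ℂ,
      ‖T v z - (2 * Complex.exp (Complex.I * z) + Complex.exp (-Complex.I * z))‖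
        ≤ ε * Real.exp |z.im| := by
  have hN := l1norm_nonneg v
  -- The `1` in the minimum ensures `ρ * l1norm v ≤ 1/2`, the `ε` gives the final bound, and the
  -- added `1` keeps the denominator positive when `v = 0`.
  set ρ := min 1 ε / (6 * (l1norm v + 1)) with hρ
  have hmin : 0 < min 1 ε := lt_min one_pos hε
  have hρ0 : 0 < ρ := by positivity
  have hρN : 6 * ρ * l1norm v ≤ min 1 ε := by
    have : 6 * ρ * (l1norm v + 1) = min 1 ε := by
      rw [hρ]
      field_simp
    nlinarith
  have hk := fun k => eventually_norm_kernel_integral_le (hv.intervalIntegrable_star k 0 1) hρ0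
  filter_upwards [hk 0, hk 1] with z h0 h1
  have hkb : KernelBound v z ρ := by
    intro k
    fin_cases k
    exacts [h0, h1]
  refine (norm_T_sub_le hv hρ0.le ?_ hkb).trans ?_
  · linarith [min_le_left 1 ε]
  · exact mul_le_mul_of_nonneg_right (hρN.trans (min_le_right _ _)) (Real.exp_pos _).le

/-! ### Asymptotics of the multipliers -/

/-- A root of a cubic that is close to `(w - 1)² (w - q)` is close to `1` or to `q`. -/
lemma cubic_root_near {q e₁ e₂ w : ℂ} {ε η : ℝ} (hq : ‖q‖ ≤ 1) (hε : 0 < ε) (hη1 : η ≤ 1)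
    (hηε : 72 * η ≤ ε ^ 3) (h₁ : ‖e₁ - (2 + q)‖ ≤ η) (h₂ : ‖e₂ - (1 + 2 * q)‖ ≤ η)
    (hw : w ^ 3 = e₁ * w ^ 2 - e₂ * w + q) : ‖w - 1‖ ≤ ε ∨ ‖w - q‖ ≤ ε := by
  have hη0 : 0 ≤ η := (norm_nonneg _).trans h₁
  have hid : (w - 1) ^ 2 * (w - q) = (e₁ - (2 + q)) * w ^ 2 - (e₂ - (1 + 2 * q)) * w := by
    linear_combination hw
  have hw0 := norm_nonneg w
  -- Both coefficients have modulus at most `3 + η ≤ 4`, so a root cannot exceed `8`. Then the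
  -- perturbation is at most `64η + 8η = 72η`.
  have hbound : ‖w‖ ≤ 8 := by
    by_contra! hlt
    have he₁ : ‖e₁‖ ≤ 4 := by
      have : e₁ = (e₁ - (2 + q)) + 2 + q := by ring
      rw [this]
      refine norm_add₃_le.trans ?_
      norm_num
      linarith
    have he₂ : ‖e₂‖ ≤ 4 := by
      have : e₂ = (e₂ - (1 + 2 * q)) + 1 + 2 * q := by ring
      rw [this]
      refine norm_add₃_le.trans ?_
      norm_num
      linarith
    have h3 : ‖w‖ ^ 3 ≤ 4 * ‖w‖ ^ 2 + 4 * ‖w‖ + 1 := by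
      rw [← norm_pow, hw]
      refine (norm_add_le _ _).trans (add_le_add ((norm_sub_le _ _).trans ?_) hq)
      rw [norm_mul, norm_mul, norm_pow]
      gcongr
    have : 8 * ‖w‖ ^ 2 ≤ ‖w‖ ^ 3 := by nlinarith [sq_nonneg ‖w‖]
    nlinarith
  have hprod : ‖w - 1‖ ^ 2 * ‖w - q‖ ≤ 72 * η := by
    rw [← norm_pow, ← norm_mul, hid]
    refine (norm_sub_le _ _).trans ?_
    rw [norm_mul, norm_mul, norm_pow]
    have h5 : ‖e₁ - (2 + q)‖ * ‖w‖ ^ 2 ≤ η * 64 :=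
      mul_le_mul h₁ (by nlinarith) (by positivity) hη0
    have h6 : ‖e₂ - (1 + 2 * q)‖ * ‖w‖ ≤ η * 8 := mul_le_mul h₂ hbound hw0 hη0
    linarith
  by_contra! h
  obtain ⟨ha, hb⟩ := h
  have h7 : ε ^ 2 < ‖w - 1‖ ^ 2 := by nlinarith
  have h8 : ε ^ 2 * ε < ‖w - 1‖ ^ 2 * ‖w - q‖ :=
    mul_lt_mul h7 hb.le hε (by positivity)
  nlinarith

/-- If a cubic is close to `(w - 1)² (w - q)` and `q` stays away from `1`, two of its roots are
close to `1`. -/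
lemma cubic_roots_near {q w₁ w₂ w₃ : ℂ} {ε η c : ℝ} (hq : ‖q‖ ≤ 1) (hc : c ≤ ‖q - 1‖)
    (hε : 0 < ε) (hη1 : η ≤ 1) (hηε : 72 * η ≤ ε ^ 3) (hεc : 3 * ε + η < c)
    (h₁ : ‖w₁ + w₂ + w₃ - (2 + q)‖ ≤ η)
    (h₂ : ‖w₁ * w₂ + w₂ * w₃ + w₃ * w₁ - (1 + 2 * q)‖ ≤ η) (h₃ : w₁ * w₂ * w₃ = q) :
    (‖w₁ - 1‖ ≤ ε ∧ ‖w₂ - 1‖ ≤ ε) ∨ (‖w₁ - 1‖ ≤ ε ∧ ‖w₃ - 1‖ ≤ ε) ∨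
      (‖w₂ - 1‖ ≤ ε ∧ ‖w₃ - 1‖ ≤ ε) := by
  have n₁ := cubic_root_near (w := w₁) hq hε hη1 hηε h₁ h₂ (by rw [← h₃]; ring)
  have n₂ := cubic_root_near (w := w₂) hq hε hη1 hηε h₁ h₂ (by rw [← h₃]; ring)
  have n₃ := cubic_root_near (w := w₃) hq hε hη1 hηε h₁ h₂ (by rw [← h₃]; ring)
  -- Two roots near `q` are impossible: wherever the third root lies, the sum of the roots, which is
  -- near `2 + q`, would put `q` within `3ε + η < c` of `1`.
  have two : ∀ a b d : ℂ, a + b + d = w₁ + w₂ + w₃ → ‖a - q‖ ≤ ε → ‖b - q‖ ≤ ε →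
      (‖d - 1‖ ≤ ε ∨ ‖d - q‖ ≤ ε) → False := by
    intro a b d hsum ha hb hd
    rw [← hsum] at h₁
    rcases hd with hd | hd
    · have : q - 1 = (a + b + d - (2 + q)) - (a - q) - (b - q) - (d - 1) := by ring
      have h4 : ‖q - 1‖ ≤ η + ε + ε + ε := by
        rw [this]
        refine (norm_sub_le _ _).trans (add_le_add ((norm_sub_le _ _).trans (add_le_add
          ((norm_sub_le _ _).trans (add_le_add h₁ ha)) hb)) hd)
      linarith
    · have : 2 * (q - 1) = (a + b + d - (2 + q)) - (a - q) - (b - q) - (d - q) := by ring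
      have h4 : ‖2 * (q - 1)‖ ≤ η + ε + ε + ε := by
        rw [this]
        refine (norm_sub_le _ _).trans (add_le_add ((norm_sub_le _ _).trans (add_le_add
          ((norm_sub_le _ _).trans (add_le_add h₁ ha)) hb)) hd)
      rw [norm_mul, Complex.norm_two] at h4
      linarith [norm_nonneg (q - 1)]
  rcases n₁ with m₁ | m₁ <;> rcases n₂ with m₂ | m₂
  · exact Or.inl ⟨m₁, m₂⟩
  · rcases n₃ with m₃ | m₃
    · exact Or.inr (Or.inl ⟨m₁, m₃⟩)
    · exact (two w₂ w₃ w₁ (by ring) m₂ m₃ (Or.inl m₁)).elim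
  · rcases n₃ with m₃ | m₃
    · exact Or.inr (Or.inr ⟨m₂, m₃⟩)
    · exact (two w₁ w₃ w₂ (by ring) m₁ m₃ (Or.inl m₂)).elim
  · exact (two w₁ w₂ w₃ (by ring) m₁ m₂ n₃).elim

/-- Continuity of the logarithm at `1` makes the bound uniform in `z`: if `e^{2iz}` were within `c`
of `1`, its logarithm `2i(z - πn)` would have modulus less than `δ` for some integer `n`. -/
lemma exists_le_norm_exp_sub_one {δ : ℝ} (hδ : 0 < δ) :
    ∃ c : ℝ, 0 < c ∧ ∀ z : ℂ, (∀ n : ℤ, δ ≤ ‖z - (Real.pi : ℂ) * (n : ℂ)‖) →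
      c ≤ ‖Complex.exp (2 * Complex.I * z) - 1‖ := by
  have hcont : ContinuousAt Complex.log 1 := continuousAt_clog (by simp)
  obtain ⟨c, hc, h⟩ := Metric.continuousAt_iff.1 hcont δ hδ
  refine ⟨c, hc, fun z hz => ?_⟩
  by_contra! hlt
  have h1 := h (x := Complex.exp (2 * Complex.I * z)) (by rwa [dist_eq_norm])
  rw [Complex.log_one, dist_zero_right] at h1
  obtain ⟨n, hn⟩ := Complex.exp_eq_exp_iff_exists_int.1
    (Complex.exp_log (Complex.exp_ne_zero (2 * Complex.I * z)))
  have h2 : Complex.log (Complex.exp (2 * Complex.I * z))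
      = 2 * Complex.I * (z - Real.pi * ((-n : ℤ) : ℂ)) := by
    rw [hn]
    push_cast
    ring
  rw [h2, norm_mul] at h1
  have h3 : ‖(2 * Complex.I : ℂ)‖ = 2 := by simp
  rw [h3] at h1
  linarith [hz (-n)]

lemma norm_sub_one_le_of_inv {s : ℂ} {ε : ℝ} (hε : ε ≤ 1 / 2) (h : ‖s⁻¹ - 1‖ ≤ ε) (h0 : s ≠ 0) :
    ‖s - 1‖ ≤ 2 * ε := by
  have h1 : s - 1 = -(s * (s⁻¹ - 1)) := by field_simp; ring
  have h2 : ‖s - 1‖ ≤ ‖s‖ * ε := by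
    rw [h1, norm_neg, norm_mul]
    exact mul_le_mul_of_nonneg_left h (norm_nonneg _)
  have h3 : ‖s‖ ≤ ‖s - 1‖ + 1 := by simpa using norm_add_le (s - 1) 1
  have hε0 : 0 ≤ ε := (norm_nonneg _).trans h
  nlinarith [norm_nonneg s, norm_nonneg (s - 1)]

/-- Here `κ² + 2κ ≤ (9/4)κ ≤ 9/16`, so `‖s r‖ ≥ 7/16`, and the quotient `36/7` is below `6`. -/
lemma norm_inv_mul_sub_one_le {s r : ℂ} {κ : ℝ} (hκ : κ ≤ 1 / 4) (hs : ‖s - 1‖ ≤ κ)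
    (hr : ‖r - 1‖ ≤ κ) : ‖(s * r)⁻¹ - 1‖ ≤ 6 * κ := by
  have hκ0 : 0 ≤ κ := (norm_nonneg _).trans hs
  have h1 : ‖s * r - 1‖ ≤ 9 / 4 * κ := by
    have : s * r - 1 = (s - 1) * (r - 1) + (s - 1) + (r - 1) := by ring
    rw [this]
    refine norm_add₃_le.trans ?_
    rw [norm_mul]
    have := mul_le_mul hs hr (norm_nonneg _) hκ0
    nlinarith
  have h2 : 7 / 16 ≤ ‖s * r‖ := by
    have : ‖(1 : ℂ)‖ ≤ ‖s * r‖ + ‖s * r - 1‖ := by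
      simpa using norm_sub_le (s * r) (s * r - 1)
    rw [norm_one] at this
    linarith
  have h0 : s * r ≠ 0 := norm_pos_iff.1 (by linarith)
  have h3 : (s * r)⁻¹ - 1 = -(s * r - 1) / (s * r) := by
    rw [neg_sub, sub_div, div_self h0, one_div]
  rw [h3, norm_div, norm_neg, div_le_iff₀ (by linarith)]
  nlinarith

/-- The relative distance of a labelled triple from the free multipliers. -/
noncomputable def freeDist (t : Fin 3 → ℂ) (z : ℂ) : ℝ :=
  ‖t 0 / freeMultiplier 0 z - 1‖ + ‖t 1 / freeMultiplier 1 z - 1‖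
    + ‖t 2 / freeMultiplier 2 z - 1‖

/-- The determinant identity makes the third ratio the inverse of the product of the other two, so
two good multipliers suffice: `κ + κ + 6κ`. -/
lemma freeDist_le {z a b c : ℂ} (habc : a * b * c = Complex.exp (Complex.I * z)) {κ : ℝ}
    (hκ : κ ≤ 1 / 4) (ha : ‖a / Complex.exp (Complex.I * z) - 1‖ ≤ κ)
    (hb : ‖b / Complex.exp (Complex.I * z) - 1‖ ≤ κ) : freeDist ![a, b, c] z ≤ 8 * κ := by
  have hc := norm_inv_mul_sub_one_le hκ ha hb
  have he := exp_neg_I_mul_mul_exp z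
  have hE : Complex.exp (Complex.I * z) ≠ 0 := Complex.exp_ne_zero _
  have hE' : Complex.exp (-Complex.I * z) ≠ 0 := Complex.exp_ne_zero _
  have hne : a * b * c ≠ 0 := habc ▸ hE
  have ha0 : a ≠ 0 := by rintro rfl; simp at hne
  have hb0 : b ≠ 0 := by rintro rfl; simp at hne
  have hc' : c / Complex.exp (-Complex.I * z)
      = (a / Complex.exp (Complex.I * z) * (b / Complex.exp (Complex.I * z)))⁻¹ := by
    generalize Complex.exp (Complex.I * z) = e at *
    generalize Complex.exp (-Complex.I * z) = e' at *
    field_simp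
    linear_combination habc - e * he
  rw [← hc'] at hc
  simp only [freeDist, freeMultiplier, Matrix.cons_val]
  linarith

lemma tendsto_star_cobounded :
    Tendsto (star : ℂ → ℂ) (Bornology.cobounded ℂ) (Bornology.cobounded ℂ) := by
  rw [← tendsto_norm_atTop_iff_cobounded]
  simpa using tendsto_norm_cobounded_atTop

lemma eventually_norm_Ttilde_sub_le (hv : IsPotential v) {ε : ℝ} (hε : 0 < ε) :
    ∀ᶠ z : ℂ in Bornology.cobounded ℂ,
      ‖Ttilde v z - (2 * Complex.exp (-Complex.I * z) + Complex.exp (Complex.I * z))‖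
        ≤ ε * Real.exp |z.im| := by
  filter_upwards [tendsto_star_cobounded.eventually (eventually_norm_T_sub_le hv hε)] with z hz
  rw [← norm_star] at hz
  simpa [Ttilde, ← Complex.exp_conj] using hz

/-- Away from `πℤ` the multipliers can be labelled to be close to the free ones. -/
lemma eventually_exists_freeDist_le (hv : IsPotential v) {δ : ℝ} (hδ : 0 < δ) {ε : ℝ}
    (hε : 0 < ε) :
    ∀ᶠ z : ℂ in awayFilter δ, ∃ t : Fin 3 → ℂ, multipliers v z = {t 0, t 1, t 2} ∧
      freeDist t z ≤ ε := by
  obtain ⟨c, hc, hcz⟩ := exists_le_norm_exp_sub_one hδ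
  -- Passing from a ratio to its inverse doubles the error, so `freeDist_le` is used with `2κ ≤ 1/4`
  -- and gives `16κ`. With `η ≤ κ`, the bound `4κ < c` is the separation condition of
  -- `cubic_roots_near`.
  obtain ⟨κ, hκ0, hκ1, hκε, hκc⟩ : ∃ κ : ℝ, 0 < κ ∧ κ ≤ 1 / 8 ∧ 16 * κ ≤ ε ∧ 4 * κ < c :=
    ⟨min (1 / 8) (min (ε / 16) (c / 5)), by positivity, min_le_left _ _, by
      linarith [(min_le_right (1 / 8 : ℝ) (min (ε / 16) (c / 5))).trans (min_le_left _ _)], by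
      linarith [(min_le_right (1 / 8 : ℝ) (min (ε / 16) (c / 5))).trans (min_le_right _ _)]⟩
  set η : ℝ := κ ^ 3 / 72 with hη
  have hη0 : 0 < η := by positivity
  have hηκ : η ≤ κ := by
    rw [hη]
    nlinarith [mul_pos hκ0 hκ0]
  rw [awayFilter, eventually_inf_principal]
  filter_upwards [eventually_norm_T_sub_le hv hη0, eventually_norm_Ttilde_sub_le hv hη0]
    with z hT hTt hz
  obtain ⟨a, b, d, h⟩ := exists_multipliers v z
  obtain ⟨v1, v2, v3⟩ := vieta hv h
  have he := exp_neg_I_mul_mul_exp z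
  have hE : Complex.exp (Complex.I * z) ≠ 0 := Complex.exp_ne_zero _
  have hE' : Complex.exp (-Complex.I * z) ≠ 0 := Complex.exp_ne_zero _
  have hne : a * b * d ≠ 0 := v3 ▸ hE
  have ha0 : a ≠ 0 := by rintro rfl; simp at hne
  have hb0 : b ≠ 0 := by rintro rfl; simp at hne
  have hd0 : d ≠ 0 := by rintro rfl; simp at hne
  have hnorm : ‖Complex.exp (Complex.I * z)‖ = Real.exp (-z.im) := by
    rw [Complex.norm_exp]; simp
  have hnorm' : ‖Complex.exp (-Complex.I * z)‖ = Real.exp z.im := by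
    rw [Complex.norm_exp]; simp
  suffices hs : (‖a / Complex.exp (Complex.I * z) - 1‖ ≤ 2 * κ ∧
        ‖b / Complex.exp (Complex.I * z) - 1‖ ≤ 2 * κ) ∨
      (‖a / Complex.exp (Complex.I * z) - 1‖ ≤ 2 * κ ∧
        ‖d / Complex.exp (Complex.I * z) - 1‖ ≤ 2 * κ) ∨
      (‖b / Complex.exp (Complex.I * z) - 1‖ ≤ 2 * κ ∧
        ‖d / Complex.exp (Complex.I * z) - 1‖ ≤ 2 * κ) by
    rcases hs with ⟨h1, h2⟩ | ⟨h1, h2⟩ | ⟨h1, h2⟩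
    · exact ⟨![a, b, d], h, (freeDist_le v3 (by linarith) h1 h2).trans (by linarith)⟩
    · refine ⟨![a, d, b], ?_, (freeDist_le (by rw [← v3]; ring) (by linarith) h1 h2).trans
        (by linarith)⟩
      rw [h]
      simp only [Multiset.insert_eq_cons, Matrix.cons_val]
      rw [← Multiset.cons_zero, ← Multiset.cons_zero, Multiset.cons_swap b d]
    · refine ⟨![b, d, a], ?_, (freeDist_le (by rw [← v3]; ring) (by linarith) h1 h2).trans
        (by linarith)⟩
      rw [h]
      simp only [Multiset.insert_eq_cons, Matrix.cons_val]
      rw [← Multiset.cons_zero, ← Multiset.cons_zero, Multiset.cons_swap a b,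
        Multiset.cons_swap a d]
  rcases le_total 0 z.im with him | him
  · -- the upper half plane: the reciprocals are bounded
    have hq : ‖Complex.exp (2 * Complex.I * z)‖ ≤ 1 := by
      rw [Complex.norm_exp, Real.exp_le_one_iff]
      simpa using him
    have hqe : Complex.exp (2 * Complex.I * z)
        = Complex.exp (Complex.I * z) * Complex.exp (Complex.I * z) := by
      rw [← Complex.exp_add]; ring_nf
    have hscale : ∀ {w : ℂ}, ‖w‖ ≤ η * Real.exp |z.im| →
        ‖Complex.exp (Complex.I * z) * w‖ ≤ η := by
      intro w hw
      rw [norm_mul, hnorm]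
      rw [abs_of_nonneg him] at hw
      calc _ ≤ Real.exp (-z.im) * (η * Real.exp z.im) :=
            mul_le_mul_of_nonneg_left hw (Real.exp_pos _).le
        _ = η := by rw [mul_left_comm, ← Real.exp_add]; simp
    have hT' := hscale hT
    have hTt' := hscale hTt
    have hinv : ∀ w : ℂ, w ≠ 0 → ‖Complex.exp (Complex.I * z) / w - 1‖ ≤ κ →
        ‖w / Complex.exp (Complex.I * z) - 1‖ ≤ 2 * κ := fun w hw hle =>
      norm_sub_one_le_of_inv (by linarith) (by rwa [inv_div]) (div_ne_zero hw hE)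
    -- The rescaled reciprocals have symmetric functions `e^{iz}T̃`, `e^{iz}T` and `e^{2iz}`, close
    -- to `2 + q`, `1 + 2q` and equal to `q` for `q = e^{2iz}`. The factor `e^{iz}` cancels the
    -- growth `e^{|Im z|}` of the errors.
    have hroots := cubic_roots_near (η := η) (w₁ := Complex.exp (Complex.I * z) / a)
      (w₂ := Complex.exp (Complex.I * z) / b) (w₃ := Complex.exp (Complex.I * z) / d)
      hq (hcz z hz) hκ0 (by linarith) (by rw [hη]; linarith) (by linarith)
      (by
        convert hTt' using 2
        rw [hqe]
        generalize Complex.exp (Complex.I * z) = e at *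
        generalize Complex.exp (-Complex.I * z) = e' at *
        rw [← v3] at v2
        have : e / a + e / b + e / d = e * Ttilde v z := by
          field_simp
          linear_combination v2
        rw [this]
        linear_combination 2 * he)
      (by
        convert hT' using 2
        rw [hqe, ← v1]
        generalize Complex.exp (Complex.I * z) = e at *
        generalize Complex.exp (-Complex.I * z) = e' at *
        have : e / a * (e / b) + e / b * (e / d) + e / d * (e / a) = e * (a + b + d) := by
          field_simp
          linear_combination (-(a + b + d)) * v3
        rw [this]
        linear_combination he)
      (by
        rw [hqe]
        field_simp
        exact v3.symm)
    rcases hroots with ⟨h1, h2⟩ | ⟨h1, h2⟩ | ⟨h1, h2⟩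
    · exact Or.inl ⟨hinv a ha0 h1, hinv b hb0 h2⟩
    · exact Or.inr (Or.inl ⟨hinv a ha0 h1, hinv d hd0 h2⟩)
    · exact Or.inr (Or.inr ⟨hinv b hb0 h1, hinv d hd0 h2⟩)
  · -- the lower half plane
    have hq : ‖Complex.exp (2 * Complex.I * -z)‖ ≤ 1 := by
      rw [Complex.norm_exp, Real.exp_le_one_iff]
      simp
      linarith
    have hqe : Complex.exp (2 * Complex.I * -z)
        = Complex.exp (-Complex.I * z) * Complex.exp (-Complex.I * z) := by
      rw [← Complex.exp_add]; ring_nf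
    have hzneg : ∀ n : ℤ, δ ≤ ‖-z - (Real.pi : ℂ) * (n : ℂ)‖ := fun n => by
      have : -z - (Real.pi : ℂ) * (n : ℂ) = -(z - (Real.pi : ℂ) * ((-n : ℤ) : ℂ)) := by
        push_cast
        ring
      rw [this, norm_neg]
      exact hz (-n)
    have hscale : ∀ {w : ℂ}, ‖w‖ ≤ η * Real.exp |z.im| →
        ‖Complex.exp (-Complex.I * z) * w‖ ≤ η := by
      intro w hw
      rw [norm_mul, hnorm']
      rw [abs_of_nonpos him] at hw
      calc _ ≤ Real.exp z.im * (η * Real.exp (-z.im)) :=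
            mul_le_mul_of_nonneg_left hw (Real.exp_pos _).le
        _ = η := by rw [mul_left_comm, ← Real.exp_add]; simp
    have hT' := hscale hT
    have hTt' := hscale hTt
    have hdiv : ∀ w : ℂ, w / Complex.exp (Complex.I * z) = Complex.exp (-Complex.I * z) * w := by
      intro w
      rw [div_eq_iff hE]
      linear_combination (-w) * he
    simp only [hdiv]
    -- Now the rescaled multipliers themselves are used: their symmetric functions are `e^{-iz}T`,
    -- `e^{-iz}T̃` and `q = e^{-2iz}`.
    have hroots := cubic_roots_near (η := η) (w₁ := Complex.exp (-Complex.I * z) * a)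
      (w₂ := Complex.exp (-Complex.I * z) * b) (w₃ := Complex.exp (-Complex.I * z) * d)
      hq (hcz (-z) hzneg) hκ0 (by linarith) (by rw [hη]; linarith) (by linarith)
      (by
        convert hT' using 2
        rw [hqe, ← v1]
        linear_combination 2 * he)
      (by
        convert hTt' using 2
        rw [hqe]
        generalize Complex.exp (Complex.I * z) = e at *
        generalize Complex.exp (-Complex.I * z) = e' at *
        linear_combination e' * e' * v2 + (e' * Ttilde v z + 1) * he)
      (by
        rw [hqe]
        generalize Complex.exp (Complex.I * z) = e at *
        generalize Complex.exp (-Complex.I * z) = e' at *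
        linear_combination e' ^ 3 * v3 + e' ^ 2 * he)
    have hmono : ∀ {x : ℝ}, x ≤ κ → x ≤ 2 * κ := fun hx => hx.trans (by linarith)
    rcases hroots with ⟨h1, h2⟩ | ⟨h1, h2⟩ | ⟨h1, h2⟩
    · exact Or.inl ⟨hmono h1, hmono h2⟩
    · exact Or.inr (Or.inl ⟨hmono h1, hmono h2⟩)
    · exact Or.inr (Or.inr ⟨hmono h1, hmono h2⟩)

/-- A labelling closest to the free multipliers. -/
lemma exists_minimal_labelling (v : Fin 2 → ℝ → ℂ) (z : ℂ) :
    ∃ t : Fin 3 → ℂ, multipliers v z = {t 0, t 1, t 2} ∧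
      ∀ s : Fin 3 → ℂ, multipliers v z = {s 0, s 1, s 2} → freeDist t z ≤ freeDist s z := by
  classical
  have hfin : {t : Fin 3 → ℂ | multipliers v z = {t 0, t 1, t 2}}.Finite := by
    refine (Set.Finite.pi' fun _ : Fin 3 => (multipliers v z).toFinset.finite_toSet).subset ?_
    intro t ht i
    have ht' : multipliers v z = {t 0, t 1, t 2} := ht
    simp only [Finset.mem_coe, Multiset.mem_toFinset]
    rw [ht']
    fin_cases i <;> simp
  obtain ⟨a, b, c, h⟩ := exists_multipliers v z
  obtain ⟨t, ht, hmin⟩ := Set.exists_min_image _ (fun t => freeDist t z) hfin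
    ⟨![a, b, c], by simpa using h⟩
  exact ⟨t, ht, fun s hs => hmin s hs⟩

lemma freeMultiplier_ne_zero (j : Fin 3) (z : ℂ) : freeMultiplier j z ≠ 0 := by
  fin_cases j <;> exact Complex.exp_ne_zero _

lemma norm_div_freeMultiplier_sub_one_le (t : Fin 3 → ℂ) (z : ℂ) (j : Fin 3) :
    ‖t j / freeMultiplier j z - 1‖ ≤ freeDist t z := by
  have h0 := norm_nonneg (t 0 / freeMultiplier 0 z - 1)
  have h1 := norm_nonneg (t 1 / freeMultiplier 1 z - 1)
  have h2 := norm_nonneg (t 2 / freeMultiplier 2 z - 1)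
  unfold freeDist
  fin_cases j <;> simp only [Fin.zero_eta, Fin.mk_one, Fin.reduceFinMk] <;> linarith

/-- The estimate above provides labellings depending on `δ` and `ε`. The minimal labelling depends
on neither and is at least as close as each of them. -/
theorem exists_labelling_isEquivalent (hv : IsPotential v) :
    ∃ τ : Fin 3 → ℂ → ℂ,
      (∀ z : ℂ, multipliers v z = {τ 0 z, τ 1 z, τ 2 z}) ∧
      ∀ δ : ℝ, 0 < δ → ∀ j : Fin 3, τ j ~[awayFilter δ] freeMultiplier j := by
  choose t ht hmin using exists_minimal_labelling v
  refine ⟨fun j z => t z j, ht, fun δ hδ j => ?_⟩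
  refine IsLittleO.of_bound fun ε hε => ?_
  filter_upwards [eventually_exists_freeDist_le hv hδ hε] with z ⟨s, hs, hsε⟩
  have h1 := (norm_div_freeMultiplier_sub_one_le (t z) z j).trans ((hmin z s hs).trans hsε)
  have h2 : t z j - freeMultiplier j z
      = (t z j / freeMultiplier j z - 1) * freeMultiplier j z := by
    rw [sub_mul, div_mul_cancel₀ _ (freeMultiplier_ne_zero j z), one_mul]
  rw [Pi.sub_apply, h2, norm_mul]
  exact mul_le_mul_of_nonneg_right h1 (norm_nonneg _)

/-! ### Integration by parts on the line and weak derivatives -/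

/-- The integral of the derivative of an integrable function vanishes. -/
lemma HasACDeriv.integral_eq_zero {F m : ℝ → ℂ} (hF : HasACDeriv F m) (hFi : Integrable F)
    (hm : Integrable m) : ∫ x, m x = 0 := by
  -- Integrability of `m` gives limits of `F` at both ends, and integrability of `F` forces them to
  -- vanish.
  have htop : Tendsto F atTop (𝓝 (F 0 + ∫ x in Set.Ioi 0, m x)) := by
    refine ((intervalIntegral_tendsto_integral_Ioi 0 hm.integrableOn tendsto_id).const_add
      (F 0)).congr fun x => ?_
    rw [hF.integral_eq_sub]
    simp
  have hbot : Tendsto F atBot (𝓝 (F 0 - ∫ x in Set.Iic 0, m x)) := by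
    refine ((intervalIntegral_tendsto_integral_Iic 0 hm.integrableOn tendsto_id).const_sub
      (F 0)).congr fun x => ?_
    rw [hF.integral_eq_sub]
    simp
  have h1 := IntegrableAtFilter.eq_zero_of_tendsto (hFi.integrableAtFilter atTop) (fun s hs => by
    obtain ⟨b, hb⟩ := mem_atTop_sets.1 hs
    exact top_le_iff.1 ((Real.volume_Ici (a := b)).symm.le.trans (measure_mono hb))) htop
  have h2 := IntegrableAtFilter.eq_zero_of_tendsto (hFi.integrableAtFilter atBot) (fun s hs => by
    obtain ⟨b, hb⟩ := mem_atBot_sets.1 hs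
    exact top_le_iff.1 ((Real.volume_Iic (a := b)).symm.le.trans (measure_mono hb))) hbot
  have h3 : (∫ x in Set.Iic 0, m x) + ∫ x in Set.Ioi 0, m x = ∫ x, m x :=
    intervalIntegral.integral_Iic_add_Ioi hm.integrableOn hm.integrableOn
  rw [← h3]
  linear_combination h1 - h2

/-- A smooth compactly supported function with zero mean has a compactly supported primitive. -/
lemma exists_hasCompactSupport_primitive {h : ℝ → ℝ} (hh : ContDiff ℝ ∞ h)
    (hs : HasCompactSupport h) (h0 : ∫ x, h x = 0) :
    ∃ φ : ℝ → ℝ, ContDiff ℝ ∞ φ ∧ HasCompactSupport φ ∧ deriv φ = h := by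
  obtain ⟨R, hR⟩ := hs.isCompact.isBounded.subset_closedBall 0
  rw [Real.closedBall_eq_Icc] at hR
  have hzero : ∀ x, x ∉ Set.Icc (0 - R) (0 + R) → h x = 0 := fun x hx =>
    image_eq_zero_of_notMem_tsupport fun hx' => hx (hR hx')
  have hd : ∀ x, HasDerivAt (fun x => ∫ t in (-R - 1)..x, h t) (h x) x := fun x =>
    intervalIntegral.integral_hasDerivAt_right (hh.continuous.intervalIntegrable _ _)
      (hh.continuous.stronglyMeasurableAtFilter _ _) hh.continuous.continuousAt
  have hderiv : deriv (fun x => ∫ t in (-R - 1)..x, h t) = h := funext fun x => (hd x).deriv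
  refine ⟨fun x => ∫ t in (-R - 1)..x, h t, ?_, ?_, hderiv⟩
  · rw [contDiff_infty_iff_deriv, hderiv]
    exact ⟨fun x => (hd x).differentiableAt, hh⟩
  · refine HasCompactSupport.intro (isCompact_Icc (a := -R - 1) (b := |R| + 1)) fun x hx => ?_
    rw [Set.mem_Icc, not_and_or, not_le, not_le] at hx
    rcases hx with hx | hx
    · rw [intervalIntegral.integral_symm, neg_eq_zero]
      refine (intervalIntegral.integral_congr fun t ht => ?_).trans
        intervalIntegral.integral_zero
      rw [Set.uIcc_of_le hx.le] at ht
      exact hzero t fun ht' => by linarith [ht'.1, ht.2]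
    · rw [← h0]
      refine intervalIntegral.integral_eq_integral_of_support_subset fun t ht => ?_
      have := not_imp_comm.1 (hzero t) ht
      exact ⟨by linarith [this.1], by linarith [this.2, le_abs_self R]⟩

/-- The du Bois-Reymond lemma: a function with locally integrable weak derivative `m` is almost
everywhere equal to a locally absolutely continuous function with derivative `m`. -/
lemma exists_hasACDeriv_of_weak {k m : ℝ → ℂ} (hk : LocallyIntegrable k)
    (hm : ∀ a b, IntervalIntegrable m volume a b)
    (hw : ∀ φ : ℝ → ℝ, ContDiff ℝ ∞ φ → HasCompactSupport φ →
      ∫ x, (φ x • m x + deriv φ x • k x) = 0) :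
    ∃ K : ℝ → ℂ, HasACDeriv K m ∧ k =ᵐ[volume] K := by
  have hml := locallyIntegrable_of_intervalIntegrable hm
  have hP := HasACDeriv.integral hm
  set P : ℝ → ℂ := fun x => ∫ t in (0 : ℝ)..x, m t with hPdef
  have hPl : LocallyIntegrable P := hP.continuous.locallyIntegrable
  have hd' : ∀ φ : ℝ → ℝ, ContDiff ℝ ∞ φ → Continuous (deriv φ) := fun φ hφ =>
    hφ.continuous_deriv (by exact_mod_cast le_top)
  have hr : LocallyIntegrable (fun x => k x - P x) := hk.sub hPl
  have hzero : ∀ φ : ℝ → ℝ, ContDiff ℝ ∞ φ → HasCompactSupport φ →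
      ∫ x, deriv φ x • (k x - P x) = 0 := by
    intro φ hφ hφs
    have i1 := hml.integrable_smul_left_of_hasCompactSupport hφ.continuous hφs
    have i2 := hk.integrable_smul_left_of_hasCompactSupport (hd' φ hφ) hφs.deriv
    have i3 := hPl.integrable_smul_left_of_hasCompactSupport (hd' φ hφ) hφs.deriv
    have i4 := hPl.integrable_smul_left_of_hasCompactSupport hφ.continuous hφs
    have hφc : HasACDeriv (fun x => (φ x : ℂ)) (fun x => ((deriv φ x : ℝ) : ℂ)) := by
      refine (HasACDeriv.of_contDiff (Complex.ofRealCLM.contDiff.comp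
        (hφ.of_le (by exact_mod_cast le_top)))).congr (Eventually.of_forall fun x => ?_)
      exact ((hφ.differentiable (by simp) x).hasDerivAt.ofReal_comp).deriv
    have h1 : ∫ x, (deriv φ x • P x + φ x • m x) = 0 := by
      refine HasACDeriv.integral_eq_zero (F := fun x => φ x • P x) ?_ i4 (i3.add i1)
      simpa only [Complex.real_smul] using hφc.mul hP
    have h2 := hw φ hφ hφs
    rw [integral_add i3 i1] at h1
    rw [integral_add i1 i2] at h2
    simp only [smul_sub]
    rw [integral_sub i2 i3]
    linear_combination h2 - h1
  -- For a test function `η`, `η - (∫ η) ρ` has zero mean and is thus the derivative of a test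
  -- function. Hence `k - P` acts on `η` as the constant `C`, its mean against `ρ`.
  let ρ : ContDiffBump (0 : ℝ) := ⟨1, 2, one_pos, one_lt_two⟩
  have hρ : ContDiff ℝ ∞ (ρ.normed volume) := ρ.contDiff_normed
  have hρs : HasCompactSupport (ρ.normed volume) := ρ.hasCompactSupport_normed
  set C : ℂ := ∫ x, ρ.normed volume x • (k x - P x) with hC
  have hconst : ∀ᵐ x, k x - P x - C = 0 := by
    refine ae_eq_zero_of_integral_contDiff_smul_eq_zero (hr.sub (locallyIntegrable_const C))
      fun η hη hηs => ?_
    have j1 : Integrable η := hη.continuous.integrable_of_hasCompactSupport hηs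
    have j2 : Integrable (ρ.normed volume) := hρ.continuous.integrable_of_hasCompactSupport hρs
    have j3 := hr.integrable_smul_left_of_hasCompactSupport hη.continuous hηs
    have j4 := hr.integrable_smul_left_of_hasCompactSupport hρ.continuous hρs
    obtain ⟨φ, hφ, hφs, hφd⟩ := exists_hasCompactSupport_primitive
      (h := fun x => η x - (∫ y, η y) * ρ.normed volume x) (hη.sub (contDiff_const.mul hρ))
      (hηs.sub hρs.mul_left) (by
        rw [integral_sub j1 (j2.const_mul _), integral_const_mul, ρ.integral_normed]
        ring)
    have h1 := hzero φ hφ hφs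
    rw [hφd] at h1
    simp only [sub_smul, mul_smul] at h1
    have j5 : Integrable (fun x => (∫ y, η y) • ρ.normed volume x • (k x - P x)) :=
      j4.smul (∫ y, η y)
    rw [integral_sub j3 j5, integral_smul, ← hC] at h1
    have h2 : ∀ x, η x • (k x - P x - C) = η x • (k x - P x) - η x • C := fun x => smul_sub _ _ _
    simp only [h2]
    rw [integral_sub j3 (j1.smul_const C), integral_smul_const]
    exact h1
  refine ⟨fun x => C + P x, ((HasACDeriv.const C).add hP).congr
    (Eventually.of_forall fun x => by simp), ?_⟩
  filter_upwards [hconst] with x hx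
  linear_combination hx

/-! ### The operator is symmetric and closed -/

lemma mem_graph_of_solves {u g : ℝ → C3} (hu : Solves v u g) (hu2 : MemLp u 2 volume)
    (hg2 : MemLp g 2 volume) : (hu2.toLp, hg2.toLp) ∈ graph v :=
  ⟨u, hu2.coeFn_toLp, hu.congr hg2.coeFn_toLp.symm⟩

/-- The Leibniz rule for multiplication by a smooth scalar function. -/
lemma Solves.smul {u g : ℝ → C3} (hu : Solves v u g) {φ : ℝ → ℝ} (hφ : ContDiff ℝ 1 φ) :
    Solves v (fun x => (φ x : ℂ) • u x)
      (fun x => (φ x : ℂ) • g x + ((deriv φ x : ℝ) : ℂ) • expr v x 0 (u x)) := by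
  have hc : ContDiff ℝ 1 (fun x => (φ x : ℂ)) := Complex.ofRealCLM.contDiff.comp hφ
  refine ⟨fun a b => (hc.contDiffOn.absolutelyContinuousOnInterval).smul (hu.1 a b), ?_⟩
  filter_upwards [hu.2] with x ⟨p, hp, he⟩
  have hd := (hφ.differentiable one_ne_zero x).hasDerivAt.ofReal_comp
  refine ⟨(φ x : ℂ) • p + ((deriv φ x : ℝ) : ℂ) • u x, hd.smul hp, ?_⟩
  rw [← he, ← expr_smul, ← expr_smul, smul_zero, ← expr_add, add_zero]

lemma norm_form_le (w u : C3) : ‖form w u‖ ≤ ‖w‖ ^ 2 + ‖u‖ ^ 2 := by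
  rw [EuclideanSpace.norm_sq_eq, EuclideanSpace.norm_sq_eq, Fin.sum_univ_three,
    Fin.sum_univ_three, form]
  refine (norm_sub_le _ _).trans ((add_le_add (norm_sub_le _ _) le_rfl).trans ?_)
  simp only [norm_mul, norm_star]
  nlinarith [sq_nonneg (‖w 0‖ - ‖u 0‖), sq_nonneg (‖w 1‖ - ‖u 1‖), sq_nonneg (‖w 2‖ - ‖u 2‖),
    sq_nonneg (‖w 0‖ + ‖u 0‖), sq_nonneg (‖w 1‖ + ‖u 1‖), sq_nonneg (‖w 2‖ + ‖u 2‖)]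

/-- The Lagrange identity integrated over the line: the form of two `L²` functions is integrable, so
there are no boundary terms at infinity. -/
lemma inner_eq_inner_of_mem_graph {q r : L2 × L2} (hq : q ∈ graph v) (hr : r ∈ graph v) :
    inner ℂ q.2 r.1 = inner ℂ q.1 r.2 := by
  obtain ⟨w, hw1, hw⟩ := hq
  obtain ⟨u, hu1, hu⟩ := hr
  have hd := hasACDeriv_form hw hu
  have hi1 : Integrable (fun x => inner ℂ (q.2 x) (u x)) :=
    (L2.integrable_inner q.2 r.1).congr (by filter_upwards [hu1] with x hx; rw [hx])
  have hi2 : Integrable (fun x => inner ℂ (w x) (r.2 x)) :=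
    (L2.integrable_inner q.1 r.2).congr (by filter_upwards [hw1] with x hx; rw [hx])
  have hw2 : MemLp w 2 volume := (memLp_congr_ae hw1).1 (Lp.memLp q.1)
  have hu2 : MemLp u 2 volume := (memLp_congr_ae hu1).1 (Lp.memLp r.1)
  have hF : Integrable (fun x => form (w x) (u x)) := by
    refine Integrable.mono' (((memLp_two_iff_integrable_sq_norm hw2.1).1 hw2).add
      ((memLp_two_iff_integrable_sq_norm hu2.1).1 hu2)) hd.continuous.aestronglyMeasurable
      (ae_of_all _ fun x => norm_form_le _ _)
  have h := hd.integral_eq_zero hF ((hi1.sub hi2).const_mul _)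
  rw [integral_const_mul, integral_sub hi1 hi2] at h
  have h' := (mul_eq_zero.1 h).resolve_left Complex.I_ne_zero
  rw [L2.inner_def, L2.inner_def]
  calc _ = ∫ x, inner ℂ (q.2 x) (u x) := integral_congr_ae (by
        filter_upwards [hu1] with x hx; rw [hx])
    _ = ∫ x, inner ℂ (w x) (r.2 x) := sub_eq_zero.1 h'
    _ = _ := integral_congr_ae (by filter_upwards [hw1] with x hx; rw [hx])

/-- The resolvent estimate. -/
lemma norm_le_of_mem_graph {q : L2 × L2} (hq : q ∈ graph v) (z : ℂ) :
    |z.im| * ‖q.1‖ ≤ ‖q.2 - z • q.1‖ := by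
  have hsym := inner_eq_inner_of_mem_graph hq hq
  have hreal : (inner ℂ q.1 q.2 : ℂ).im = 0 := by
    have h := inner_conj_symm (𝕜 := ℂ) q.1 q.2
    rw [hsym] at h
    exact Complex.conj_eq_iff_im.1 h
  -- By symmetry the quadratic form is real, so the imaginary part comes from `z` alone.
  have h1 : (inner ℂ q.1 (q.2 - z • q.1) : ℂ).im = -(z.im * ‖q.1‖ ^ 2) := by
    rw [inner_sub_right, inner_smul_right, inner_self_eq_norm_sq_to_K, Complex.sub_im, hreal]
    have : ((‖q.1‖ : ℝ) : ℂ) ^ 2 = ((‖q.1‖ ^ 2 : ℝ) : ℂ) := by push_cast; rfl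
    erw [this, Complex.im_mul_ofReal]
    ring
  have h2 : |z.im| * ‖q.1‖ ^ 2 ≤ ‖q.1‖ * ‖q.2 - z • q.1‖ := by
    calc |z.im| * ‖q.1‖ ^ 2 = |(inner ℂ q.1 (q.2 - z • q.1) : ℂ).im| := by
          rw [h1, abs_neg, abs_mul, abs_of_nonneg (sq_nonneg ‖q.1‖)]
      _ ≤ ‖(inner ℂ q.1 (q.2 - z • q.1) : ℂ)‖ := Complex.abs_im_le_norm _
      _ ≤ _ := norm_inner_le_norm _ _
  rcases eq_or_lt_of_le (norm_nonneg q.1) with h0 | h0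
  · rw [← h0, mul_zero]
    exact norm_nonneg _
  · have : ‖q.1‖ * (|z.im| * ‖q.1‖) ≤ ‖q.1‖ * ‖q.2 - z • q.1‖ := by linarith
    exact le_of_mul_le_mul_left this h0

/-! ### Test functions -/

lemma memLp_test_mul {f : ℝ → ℂ} (hf : AEStronglyMeasurable f volume)
    (hf2 : ∀ a b, IntervalIntegrable (fun x => ‖f x‖ ^ 2) volume a b) {φ : ℝ → ℝ}
    (hφ : Continuous φ) (hφs : HasCompactSupport φ) :
    MemLp (fun x => (φ x : ℂ) * f x) 2 volume := by
  have hm : AEStronglyMeasurable (fun x => (φ x : ℂ) * f x) volume :=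
    (Complex.continuous_ofReal.comp hφ).aestronglyMeasurable.mul hf
  rw [memLp_two_iff_integrable_sq_norm hm]
  have h := (locallyIntegrable_of_intervalIntegrable
    hf2).integrable_smul_left_of_hasCompactSupport (g := fun x => φ x ^ 2) (hφ.pow 2)
    (hφs.comp_left (g := fun y : ℝ => y ^ 2) (by simp))
  refine h.congr (ae_of_all _ fun x => ?_)
  simp [mul_pow]

lemma memLp_ofReal_test {φ : ℝ → ℝ} (hφ : Continuous φ) (hφs : HasCompactSupport φ) :
    MemLp (fun x => (φ x : ℂ)) 2 volume :=
  (Complex.continuous_ofReal.comp hφ).memLp_of_hasCompactSupport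
    (hφs.comp_left (g := fun y : ℝ => (y : ℂ)) (by simp))

lemma solves_const (v : Fin 2 → ℝ → ℂ) (e : C3) :
    Solves v (fun _ => e) (fun x => expr v x e 0) :=
  ⟨fun _ _ => (LipschitzWith.const e).lipschitzOnWith.absolutelyContinuousOnInterval,
    Eventually.of_forall fun x => ⟨0, hasDerivAt_const x e, rfl⟩⟩

/-- The image of the test function `φ e` under `iJ d/dx + V`. -/
noncomputable def testImage (v : Fin 2 → ℝ → ℂ) (φ : ℝ → ℝ) (e : C3) (x : ℝ) : C3 :=
  (φ x : ℂ) • expr v x e 0 + ((deriv φ x : ℝ) : ℂ) • expr v x 0 e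

lemma testImage_zero (v : Fin 2 → ℝ → ℂ) (φ : ℝ → ℝ) (e : C3) (x : ℝ) :
    testImage v φ e x 0 = ((φ x : ℂ) * star (v 0 x)) * e 1 + ((φ x : ℂ) * star (v 1 x)) * e 2
      + ((deriv φ x : ℝ) : ℂ) * (Complex.I * e 0) := by
  rw [testImage, PiLp.add_apply, PiLp.smul_apply, PiLp.smul_apply, expr_apply_zero,
    expr_apply_zero]
  simp only [smul_eq_mul, PiLp.zero_apply]
  ring

lemma testImage_one (v : Fin 2 → ℝ → ℂ) (φ : ℝ → ℝ) (e : C3) (x : ℝ) :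
    testImage v φ e x 1 = ((φ x : ℂ) * v 0 x) * e 0
      + ((deriv φ x : ℝ) : ℂ) * (-Complex.I * e 1) := by
  rw [testImage, PiLp.add_apply, PiLp.smul_apply, PiLp.smul_apply, expr_apply_one,
    expr_apply_one]
  simp only [smul_eq_mul, PiLp.zero_apply]
  ring

lemma testImage_two (v : Fin 2 → ℝ → ℂ) (φ : ℝ → ℝ) (e : C3) (x : ℝ) :
    testImage v φ e x 2 = ((φ x : ℂ) * v 1 x) * e 0
      + ((deriv φ x : ℝ) : ℂ) * (-Complex.I * e 2) := by
  rw [testImage, PiLp.add_apply, PiLp.smul_apply, PiLp.smul_apply, expr_apply_two,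
    expr_apply_two]
  simp only [smul_eq_mul, PiLp.zero_apply]
  ring

lemma continuous_deriv_test {φ : ℝ → ℝ} (hφ : ContDiff ℝ ∞ φ) : Continuous (deriv φ) :=
  hφ.continuous_deriv (by exact_mod_cast le_top)

/-- Local square integrability of `v` is what places test functions in the maximal domain. -/
lemma memLp_testImage (hv : IsPotential v) {φ : ℝ → ℝ} (hφ : ContDiff ℝ ∞ φ)
    (hφs : HasCompactSupport φ) (e : C3) : MemLp (testImage v φ e) 2 volume := by
  have hd := memLp_ofReal_test (continuous_deriv_test hφ) hφs.deriv
  have hvk : ∀ k, MemLp (fun x => (φ x : ℂ) * v k x) 2 volume := fun k =>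
    memLp_test_mul (hv.aestronglyMeasurable k) (hv.intervalIntegrable_sq k) hφ.continuous hφs
  have hvs : ∀ k, MemLp (fun x => (φ x : ℂ) * star (v k x)) 2 volume := fun k =>
    memLp_test_mul (continuous_star.comp_aestronglyMeasurable (hv.aestronglyMeasurable k))
      (by simpa only [norm_star] using hv.intervalIntegrable_sq k) hφ.continuous hφs
  refine MemLp.of_eval_piLp fun i => ?_
  fin_cases i
  · refine MemLp.ae_eq (ae_of_all _ fun x => (testImage_zero v φ e x).symm)
      ((((hvs 0).mul_const (e 1)).add ((hvs 1).mul_const (e 2))).add (hd.mul_const _))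
  · refine MemLp.ae_eq (ae_of_all _ fun x => (testImage_one v φ e x).symm)
      (((hvk 0).mul_const (e 0)).add (hd.mul_const _))
  · refine MemLp.ae_eq (ae_of_all _ fun x => (testImage_two v φ e x).symm)
      (((hvk 1).mul_const (e 0)).add (hd.mul_const _))

lemma memLp_test {φ : ℝ → ℝ} (hφ : Continuous φ) (hφs : HasCompactSupport φ) (e : C3) :
    MemLp (fun x => (φ x : ℂ) • e) 2 volume :=
  ((Complex.continuous_ofReal.comp hφ).smul continuous_const).memLp_of_hasCompactSupport
    (HasCompactSupport.smul_right (hφs.comp_left (g := fun y : ℝ => (y : ℂ)) (by simp)))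

lemma test_mem_graph (hv : IsPotential v) {φ : ℝ → ℝ} (hφ : ContDiff ℝ ∞ φ)
    (hφs : HasCompactSupport φ) (e : C3) :
    ((memLp_test hφ.continuous hφs e).toLp, (memLp_testImage hv hφ hφs e).toLp) ∈ graph v :=
  mem_graph_of_solves ((solves_const v e).smul (hφ.of_le (by exact_mod_cast le_top))) _ _

lemma locallyIntegrable_coord (f : L2) (i : Fin 3) : LocallyIntegrable (fun x => f x i) :=
  ((Lp.memLp f).eval_piLp i).locallyIntegrable one_le_two

lemma intervalIntegrable_of_locallyIntegrable {f : ℝ → ℂ} (hf : LocallyIntegrable f) (a b : ℝ) :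
    IntervalIntegrable f volume a b :=
  (hf.integrableOn_isCompact isCompact_uIcc).intervalIntegrable

lemma intervalIntegrable_mul_coord {h : ℝ → ℂ} (hh : AEStronglyMeasurable h volume)
    (h2 : ∀ a b, IntervalIntegrable (fun x => ‖h x‖ ^ 2) volume a b) (f : L2) (i : Fin 3)
    (a b : ℝ) : IntervalIntegrable (fun x => h x * f x i) volume a b := by
  have key : ∀ a b, IntegrableOn (fun x => ‖h x‖ ^ 2) (Set.Ioc a b) volume →
      IntegrableOn (fun x => h x * f x i) (Set.Ioc a b) volume := fun a b hi =>
    ((memLp_two_iff_integrable_sq_norm hh.restrict).2 hi).integrable_mul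
      (((Lp.memLp f).eval_piLp i).restrict _)
  exact ⟨key a b (h2 a b).1, key b a (h2 a b).2⟩

/-- A pair that satisfies the equation in the weak sense belongs to the graph. -/
lemma mem_graph_of_weak (hv : IsPotential v) (q : L2 × L2)
    (hw : ∀ r ∈ graph v, inner ℂ r.2 q.1 = inner ℂ r.1 q.2) : q ∈ graph v := by
  obtain ⟨f, g⟩ := q
  have hweak : ∀ (e : C3) (φ : ℝ → ℝ), ContDiff ℝ ∞ φ → HasCompactSupport φ →
      ∫ x, (inner ℂ ((φ x : ℂ) • e) (g x) - inner ℂ (testImage v φ e x) (f x) : ℂ) = 0 := by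
    intro e φ hφ hφs
    have h := hw _ (test_mem_graph hv hφ hφs e)
    simp only [L2.inner_def] at h
    have hae1 := (memLp_test hφ.continuous hφs e).coeFn_toLp
    have hae2 := (memLp_testImage hv hφ hφs e).coeFn_toLp
    have i1 := (L2.integrable_inner (𝕜 := ℂ) (memLp_test hφ.continuous hφs e).toLp g)
    have i2 := (L2.integrable_inner (𝕜 := ℂ) (memLp_testImage hv hφ hφs e).toLp f)
    have h' := (integral_sub i1 i2).trans (sub_eq_zero.2 h.symm)
    rw [← h']
    refine integral_congr_ae ?_
    filter_upwards [hae1, hae2] with x h1 h2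
    rw [h1, h2]
  have hst : ∀ k, AEStronglyMeasurable (fun x => star (v k x)) volume := fun k =>
    continuous_star.comp_aestronglyMeasurable (hv.aestronglyMeasurable k)
  have hst2 : ∀ k a b, IntervalIntegrable (fun x => ‖star (v k x)‖ ^ 2) volume a b := fun k => by
    simpa only [norm_star] using hv.intervalIntegrable_sq k
  have hg := fun i a b => (intervalIntegrable_of_locallyIntegrable (locallyIntegrable_coord g i) a b)
  -- Testing with `φ` times a basis vector gives the weak form of one scalar equation; the factor
  -- `-i`, or `i` for the other two, inverts the corresponding entry of `iJ`.
  obtain ⟨K0, hK0, e0⟩ := exists_hasACDeriv_of_weak (locallyIntegrable_coord f 0)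
    (m := fun x => -Complex.I * (g x 0 - star (v 0 x) * f x 1 - star (v 1 x) * f x 2))
    (fun a b => (((hg 0 a b).sub (intervalIntegrable_mul_coord (hst 0) (hst2 0) f 1 a b)).sub
      (intervalIntegrable_mul_coord (hst 1) (hst2 1) f 2 a b)).const_mul _)
    (fun φ hφ hφs => by
      have h := congrArg (fun w => -Complex.I * w)
        (hweak (EuclideanSpace.single 0 1) φ hφ hφs)
      simp only [mul_zero] at h
      rw [← integral_const_mul] at h
      rw [← h]
      refine integral_congr_ae (ae_of_all _ fun x => ?_)
      simp [PiLp.inner_apply, Fin.sum_univ_three, testImage_zero, testImage_one, testImage_two]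
      linear_combination (((deriv φ x : ℝ) : ℂ) * f x 0) * Complex.I_mul_I)
  obtain ⟨K1, hK1, e1⟩ := exists_hasACDeriv_of_weak (locallyIntegrable_coord f 1)
    (m := fun x => Complex.I * (g x 1 - v 0 x * f x 0))
    (fun a b => ((hg 1 a b).sub (intervalIntegrable_mul_coord (hv.aestronglyMeasurable 0)
      (hv.intervalIntegrable_sq 0) f 0 a b)).const_mul _)
    (fun φ hφ hφs => by
      have h := congrArg (fun w => Complex.I * w)
        (hweak (EuclideanSpace.single 1 1) φ hφ hφs)
      simp only [mul_zero] at h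
      rw [← integral_const_mul] at h
      rw [← h]
      refine integral_congr_ae (ae_of_all _ fun x => ?_)
      simp [PiLp.inner_apply, Fin.sum_univ_three, testImage_zero, testImage_one, testImage_two]
      linear_combination (((deriv φ x : ℝ) : ℂ) * f x 1) * Complex.I_mul_I)
  obtain ⟨K2, hK2, e2⟩ := exists_hasACDeriv_of_weak (locallyIntegrable_coord f 2)
    (m := fun x => Complex.I * (g x 2 - v 1 x * f x 0))
    (fun a b => ((hg 2 a b).sub (intervalIntegrable_mul_coord (hv.aestronglyMeasurable 1)
      (hv.intervalIntegrable_sq 1) f 0 a b)).const_mul _)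
    (fun φ hφ hφs => by
      have h := congrArg (fun w => Complex.I * w)
        (hweak (EuclideanSpace.single 2 1) φ hφ hφs)
      simp only [mul_zero] at h
      rw [← integral_const_mul] at h
      rw [← h]
      refine integral_congr_ae (ae_of_all _ fun x => ?_)
      simp [PiLp.inner_apply, Fin.sum_univ_three, testImage_zero, testImage_one, testImage_two]
      linear_combination (((deriv φ x : ℝ) : ℂ) * f x 2) * Complex.I_mul_I)
  refine ⟨fun x => !₂[K0 x, K1 x, K2 x], ?_, solves_iff.2 ⟨hK0.congr ?_, hK1.congr ?_,
    hK2.congr ?_⟩⟩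
  · filter_upwards [e0, e1, e2] with x h0 h1 h2
    ext i
    fin_cases i
    exacts [h0, h1, h2]
  · filter_upwards [e1, e2] with x h1 h2
    rw [h1, h2]
    rfl
  · filter_upwards [e0] with x h0
    rw [h0]
    rfl
  · filter_upwards [e0] with x h0
    rw [h0]
    rfl

/-- Symmetry and the weak characterisation together say that the graph equals that of the adjoint,
an intersection of closed conditions. -/
lemma isClosed_graph (hv : IsPotential v) : IsClosed (graph v : Set (L2 × L2)) := by
  have h : (graph v : Set (L2 × L2))
      = ⋂ r ∈ graph v, {q : L2 × L2 | inner ℂ r.2 q.1 = inner ℂ r.1 q.2} := by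
    ext q
    simp only [SetLike.mem_coe, Set.mem_iInter, Set.mem_ofPred_eq]
    exact ⟨fun hq r hr => inner_eq_inner_of_mem_graph hr hq, mem_graph_of_weak hv q⟩
  rw [h]
  exact isClosed_biInter fun r _ => isClosed_eq (by fun_prop) (by fun_prop)

/-! ### The spectrum -/

/-- The map `(f, 𝓛 f) ↦ 𝓛 f - z f` on the graph. -/
noncomputable def shiftMap (v : Fin 2 → ℝ → ℂ) (z : ℂ) : graph v →L[ℂ] L2 :=
  (ContinuousLinearMap.snd ℂ L2 L2 - z • ContinuousLinearMap.fst ℂ L2 L2).comp (graph v).subtypeL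

lemma shiftMap_apply (z : ℂ) (q : graph v) :
    shiftMap v z q = (q : L2 × L2).2 - z • (q : L2 × L2).1 := rfl

lemma antilipschitz_shiftMap {z : ℂ} (hz : z.im ≠ 0) : ∃ K, AntilipschitzWith K (shiftMap v z) := by
  have him : 0 < |z.im| := abs_pos.2 hz
  refine ⟨⟨|z.im|⁻¹ + (1 + ‖z‖ * |z.im|⁻¹), by positivity⟩,
    ContinuousLinearMap.antilipschitz_of_bound _ fun q => ?_⟩
  have h1 := norm_le_of_mem_graph q.2 z
  rw [← shiftMap_apply] at h1
  set w := shiftMap v z q with hw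
  have h2 : ‖(q : L2 × L2).1‖ ≤ |z.im|⁻¹ * ‖w‖ := by
    rw [inv_mul_eq_div, le_div_iff₀ him]
    linarith
  have h3 : ‖(q : L2 × L2).2‖ ≤ ‖w‖ + ‖z‖ * (|z.im|⁻¹ * ‖w‖) := by
    have : (q : L2 × L2).2 = w + z • (q : L2 × L2).1 := by
      rw [hw, shiftMap_apply, sub_add_cancel]
    rw [this]
    refine (norm_add_le _ _).trans (add_le_add le_rfl ?_)
    rw [norm_smul]
    exact mul_le_mul_of_nonneg_left h2 (norm_nonneg _)
  have h4 : 0 ≤ ‖w‖ + ‖z‖ * (|z.im|⁻¹ * ‖w‖) := by positivity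
  have h5 : 0 ≤ |z.im|⁻¹ * ‖w‖ := by positivity
  change ‖(q : L2 × L2)‖ ≤ (|z.im|⁻¹ + (1 + ‖z‖ * |z.im|⁻¹)) * ‖w‖
  rw [Prod.norm_def]
  refine max_le ?_ ?_ <;> linarith

/-- A vector orthogonal to the range is a weak eigenvector at `z̄`, hence a genuine one, and the
resolvent estimate excludes nonreal eigenvalues. -/
lemma orthogonal_range_shiftMap (hv : IsPotential v) {z : ℂ} (hz : z.im ≠ 0) :
    (LinearMap.range (shiftMap v z).toLinearMap)ᗮ = ⊥ := by
  rw [Submodule.eq_bot_iff]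
  intro h hh
  rw [Submodule.mem_orthogonal] at hh
  have hmem : (h, star z • h) ∈ graph v := by
    refine mem_graph_of_weak hv _ fun r hr => ?_
    have h1 := hh _ ⟨⟨r, hr⟩, rfl⟩
    change inner ℂ (r.2 - z • r.1) h = (0 : ℂ) at h1
    rw [inner_sub_left, inner_smul_left, sub_eq_zero] at h1
    rw [inner_smul_right]
    exact h1
  have h2 := norm_le_of_mem_graph hmem (star z)
  simp only [sub_self, norm_zero] at h2
  have h3 : 0 < |(star z).im| := by simpa using hz
  exact norm_le_zero_iff.1 (nonpos_of_mul_nonpos_right h2 h3)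

/-- The graph is complete and the map is bounded below, so the range is closed; it is also dense. -/
lemma bijective_shiftMap (hv : IsPotential v) {z : ℂ} (hz : z.im ≠ 0) :
    Function.Bijective (shiftMap v z).toLinearMap := by
  obtain ⟨K, hK⟩ := antilipschitz_shiftMap (v := v) hz
  have : CompleteSpace (graph v) := (isClosed_graph hv).completeSpace_coe
  have hcl : IsClosed (Set.range (shiftMap v z)) := hK.isClosed_range
    (shiftMap v z).uniformContinuous
  refine ⟨hK.injective, LinearMap.range_eq_top.1 ?_⟩
  have htop := (Submodule.topologicalClosure_eq_top_iff).2 (orthogonal_range_shiftMap hv hz)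
  rwa [IsClosed.submodule_topologicalClosure_eq (by rw [LinearMap.coe_range]; exact hcl)] at htop

lemma mem_graph_iff_operator {q : L2 × L2} :
    q ∈ graph v ↔ ∃ f : (operator v).domain, (f : L2) = q.1 ∧ operator v f = q.2 := by
  rw [← operator_graph, LinearPMap.mem_graph_iff]

lemma isResolventPoint_of_im_ne_zero (hv : IsPotential v) {z : ℂ} (hz : z.im ≠ 0) :
    IsResolventPoint (operator v) z := by
  have him : 0 < |z.im| := abs_pos.2 hz
  let e := LinearEquiv.ofBijective _ (bijective_shiftMap hv hz)
  have he : ∀ g, (e.symm g : L2 × L2).2 - z • (e.symm g : L2 × L2).1 = g := fun g =>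
    e.apply_symm_apply g
  let R : L2 →ₗ[ℂ] L2 := (LinearMap.fst ℂ L2 L2) ∘ₗ (graph v).subtype ∘ₗ e.symm.toLinearMap
  have hR : ∀ g, R g = (e.symm g : L2 × L2).1 := fun g => rfl
  have hRb : ∀ g, ‖R g‖ ≤ |z.im|⁻¹ * ‖g‖ := by
    intro g
    have h := norm_le_of_mem_graph (e.symm g).2 z
    rw [he] at h
    rw [hR, inv_mul_eq_div, le_div_iff₀ him]
    linarith
  refine ⟨R.mkContinuous |z.im|⁻¹ hRb, fun g => ?_, fun f => ?_⟩
  · obtain ⟨f, hf1, hf2⟩ := mem_graph_iff_operator.1 (e.symm g).2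
    have hRg : R.mkContinuous |z.im|⁻¹ hRb g = (f : L2) := (hR g).trans hf1.symm
    refine ⟨hRg ▸ f.2, ?_⟩
    have hf : (⟨R.mkContinuous |z.im|⁻¹ hRb g, hRg ▸ f.2⟩ : (operator v).domain) = f :=
      Subtype.ext hRg
    rw [hf, hRg, hf2, hf1, he]
  · have hmem : ((f : L2), operator v f) ∈ graph v := mem_graph_iff_operator.2 ⟨f, rfl, rfl⟩
    have h : e ⟨_, hmem⟩ = operator v f - z • (f : L2) := rfl
    rw [← h]
    change ((e.symm (e ⟨_, hmem⟩) : graph v) : L2 × L2).1 = f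
    rw [e.symm_apply_apply]

/-! ### Weyl sequences -/

lemma norm_toLp_sq {F : ℝ → C3} (hF : MemLp F 2 volume) : ‖hF.toLp‖ ^ 2 = ∫ x, ‖F x‖ ^ 2 := by
  have h := inner_self_eq_norm_sq_to_K (𝕜 := ℂ) hF.toLp
  rw [L2.inner_def] at h
  have h2 : ∫ x, (inner ℂ (hF.toLp F x) (hF.toLp F x) : ℂ) = ((∫ x, ‖F x‖ ^ 2 : ℝ) : ℂ) := by
    refine (integral_congr_ae ?_).trans integral_complex_ofReal
    filter_upwards [hF.coeFn_toLp] with x hx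
    rw [hx, inner_self_eq_norm_sq_to_K]
    push_cast
    rfl
  rw [h2] at h
  refine Complex.ofReal_injective ?_
  rw [h]
  push_cast
  rfl

lemma norm_expr_zero_left (v : Fin 2 → ℝ → ℂ) (x : ℝ) (p : C3) : ‖expr v x 0 p‖ = ‖p‖ := by
  rw [EuclideanSpace.norm_eq, EuclideanSpace.norm_eq, Fin.sum_univ_three, Fin.sum_univ_three,
    expr_apply_zero, expr_apply_one, expr_apply_two]
  simp

lemma integral_norm_sq_bloch {u : ℝ → C3} (hc : Continuous u) (hp : ∀ x, ‖u (x + 1)‖ = ‖u x‖)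
    (n : ℕ) : ∫ x in (-n : ℝ)..n, ‖u x‖ ^ 2 = 2 * n * ∫ x in (0 : ℝ)..1, ‖u x‖ ^ 2 := by
  have hper : Function.Periodic (fun x => ‖u x‖ ^ 2) 1 := fun x => by simp only [hp]
  have hi : ∀ a b, IntervalIntegrable (fun x => ‖u x‖ ^ 2) volume a b := fun a b =>
    (hc.norm.pow 2).intervalIntegrable a b
  have h1 := hper.intervalIntegral_add_zsmul_eq (2 * n : ℤ) (-n) hi
  have h2 := hper.intervalIntegral_add_eq (-n : ℝ) 0
  rw [h2] at h1
  have e1 : (-n : ℝ) + (2 * n : ℤ) • (1 : ℝ) = n := by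
    simp
    ring
  rw [e1] at h1
  rw [h1]
  simp

lemma not_isResolventPoint_ofReal (hv : IsPotential v) (t : ℝ) :
    ¬ IsResolventPoint (operator v) t := by
  rintro ⟨R, -, hR⟩
  obtain ⟨u, hu, hu0, hp⟩ := exists_bloch hv t
  have hc := hu.continuous
  have hbound : ∀ q ∈ graph v, ‖q.1‖ ≤ ‖R‖ * ‖q.2 - (t : ℂ) • q.1‖ := by
    intro q hq
    obtain ⟨f, hf1, hf2⟩ := mem_graph_iff_operator.1 hq
    have h := hR f
    rw [hf1, hf2] at h
    calc ‖q.1‖ = ‖R (q.2 - (t : ℂ) • q.1)‖ := by rw [h]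
      _ ≤ _ := R.le_opNorm _
  set A := ∫ x in (0 : ℝ)..1, ‖u x‖ ^ 2 with hA
  have hApos : 0 < A := by
    refine intervalIntegral.integral_pos zero_lt_one (hc.norm.pow 2).continuousOn
      (fun x _ => by positivity) ⟨0, by simp, ?_⟩
    have := norm_pos_iff.2 hu0
    positivity
  let χ : ContDiffBump (0 : ℝ) := ⟨1, 2, one_pos, one_lt_two⟩
  have hχ : ContDiff ℝ 1 χ := χ.contDiff
  have hχd : Continuous (deriv χ) := hχ.continuous_deriv le_rfl
  obtain ⟨C, hC⟩ := hχd.bounded_above_of_compact_support χ.hasCompactSupport.deriv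
  have hC0 : 0 ≤ C := (norm_nonneg _).trans (hC 0)
  -- With `φ(x) = χ(x/n)`, the squared norm of `φu` is at least `2nA`, since `φ = 1` on `[-n, n]`.
  -- Applying the operator minus `t` leaves only the term with `φ'`, of size `C/n` on `[-2n, 2n]`,
  -- with squared norm at most `(C/n)² · 4nA`. A bounded resolvent would therefore bound `n`.
  have key : ∀ n : ℕ, 0 < n → (n : ℝ) ^ 2 ≤ 2 * (‖R‖ * C) ^ 2 := by
    intro n hn
    have hn' : (0 : ℝ) < n := by exact_mod_cast hn
    set φ : ℝ → ℝ := fun x => χ (x / n) with hφdef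
    have hφ : ContDiff ℝ 1 φ := hχ.comp (contDiff_id.div_const _)
    have hφd : ∀ x, deriv φ x = deriv χ (x / n) / n := fun x => by
      have h1 : HasDerivAt (fun x : ℝ => x / n) (1 / n) x := (hasDerivAt_id x).div_const _
      have h2 := ((hχ.differentiable one_ne_zero (x / n)).hasDerivAt).comp x h1
      rw [show φ = χ ∘ fun x : ℝ => x / n from rfl, h2.deriv]
      ring
    have hout : ∀ x, x ∉ Set.Icc (-(2 * n : ℕ) : ℝ) (2 * n : ℕ) → 2 ≤ |x / n| := by
      intro x hx
      rw [abs_div, abs_of_pos hn', le_div_iff₀ hn']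
      by_contra! hlt
      have := abs_lt.1 hlt
      exact hx ⟨by push_cast; linarith, by push_cast; linarith⟩
    have hφ0 : ∀ x, x ∉ Set.Icc (-(2 * n : ℕ) : ℝ) (2 * n : ℕ) → φ x = 0 := fun x hx =>
      χ.zero_of_le_dist (by
        rw [dist_zero_right, Real.norm_eq_abs]
        exact hout x hx)
    have hφs : HasCompactSupport φ := HasCompactSupport.intro isCompact_Icc hφ0
    have hφ1 : ∀ x ∈ Set.Icc (-n : ℝ) n, φ x = 1 := fun x hx =>
      χ.one_of_mem_closedBall (by
        rw [mem_closedBall_zero_iff, Real.norm_eq_abs, abs_div, abs_of_pos hn']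
        exact (div_le_one hn').2 (abs_le.2 hx))
    have hsolve := hu.smul hφ
    have hm1 : MemLp (fun x => (φ x : ℂ) • u x) 2 volume :=
      ((Complex.continuous_ofReal.comp hφ.continuous).smul hc).memLp_of_hasCompactSupport
        (HasCompactSupport.smul_right (hφs.comp_left (g := fun y : ℝ => (y : ℂ)) (by simp)))
    have hexpr : Continuous fun x => expr v x 0 (u x) := by
      have : ∀ x, expr v x 0 (u x)
          = WithLp.toLp 2 (Complex.I • (J.mulVec (u x).ofLp)) := fun x => by simp [expr]
      simp only [this]
      fun_prop
    have hm2 : MemLp (fun x => ((deriv φ x : ℝ) : ℂ) • expr v x 0 (u x)) 2 volume :=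
      ((Complex.continuous_ofReal.comp (hφ.continuous_deriv le_rfl)).smul
        hexpr).memLp_of_hasCompactSupport
        (HasCompactSupport.smul_right (hφs.deriv.comp_left (g := fun y : ℝ => (y : ℂ)) (by simp)))
    have hsolve' : Solves v (fun x => (φ x : ℂ) • u x) (fun x => (t : ℂ) • ((φ x : ℂ) • u x)
        + ((deriv φ x : ℝ) : ℂ) • expr v x 0 (u x)) :=
      hsolve.congr (Eventually.of_forall fun x => by
        simp only [smul_comm (t : ℂ)])
    have hm3 := (hm1.const_smul (t : ℂ)).add hm2
    have hgraph := mem_graph_of_solves hsolve' hm1 hm3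
    have hb := hbound _ hgraph
    have hdiff : hm3.toLp - (t : ℂ) • hm1.toLp = hm2.toLp := by
      rw [MemLp.toLp_add (hm1.const_smul (t : ℂ)) hm2, MemLp.toLp_const_smul (t : ℂ) hm1]
      abel
    change ‖hm1.toLp‖ ≤ ‖R‖ * ‖hm3.toLp - (t : ℂ) • hm1.toLp‖ at hb
    rw [hdiff] at hb
    have hb2 : ‖hm1.toLp‖ ^ 2 ≤ ‖R‖ ^ 2 * ‖hm2.toLp‖ ^ 2 := by
      rw [← mul_pow]
      exact pow_le_pow_left₀ (norm_nonneg _) hb 2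
    rw [norm_toLp_sq, norm_toLp_sq] at hb2
    have hlow : 2 * n * A ≤ ∫ x, ‖(φ x : ℂ) • u x‖ ^ 2 := by
      rw [hA, ← integral_norm_sq_bloch hc hp,
        intervalIntegral.integral_of_le (by linarith : (-n : ℝ) ≤ n)]
      calc ∫ x in Set.Ioc (-n : ℝ) n, ‖u x‖ ^ 2
          = ∫ x in Set.Ioc (-n : ℝ) n, ‖(φ x : ℂ) • u x‖ ^ 2 :=
            setIntegral_congr_fun measurableSet_Ioc fun x hx => by
              simp only [hφ1 x ⟨hx.1.le, hx.2⟩, Complex.ofReal_one, one_smul]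
        _ ≤ _ := setIntegral_le_integral ((memLp_two_iff_integrable_sq_norm hm1.1).1 hm1)
            (ae_of_all _ fun x => by positivity)
    have hup : ∫ x, ‖((deriv φ x : ℝ) : ℂ) • expr v x 0 (u x)‖ ^ 2
        ≤ (C / n) ^ 2 * (2 * (2 * n : ℕ) * A) := by
      have hsupp : ∀ x, x ∉ Set.Icc (-(2 * n : ℕ) : ℝ) (2 * n : ℕ) → deriv φ x = 0 := by
        intro x hx
        have hev : φ =ᶠ[𝓝 x] fun _ => 0 := by
          filter_upwards [isClosed_Icc.isOpen_compl.mem_nhds hx] with y hy using hφ0 y hy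
        rw [hev.deriv_eq, deriv_const]
      have hle : (-(2 * n : ℕ) : ℝ) ≤ (2 * n : ℕ) := by push_cast; linarith
      rw [hA, ← integral_norm_sq_bloch hc hp, intervalIntegral.integral_of_le hle,
        ← integral_Icc_eq_integral_Ioc, ← integral_const_mul]
      rw [← setIntegral_eq_integral_of_forall_compl_eq_zero
        (s := Set.Icc (-(2 * n : ℕ) : ℝ) (2 * n : ℕ)) fun x hx => by simp [hsupp x hx]]
      refine setIntegral_mono_on ((memLp_two_iff_integrable_sq_norm hm2.1).1 hm2).integrableOn
        ((continuous_const.mul (hc.norm.pow 2)).continuousOn.integrableOn_Icc) measurableSet_Icc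
        fun x _ => ?_
      rw [norm_smul, norm_expr_zero_left, mul_pow]
      refine mul_le_mul_of_nonneg_right (pow_le_pow_left₀ (norm_nonneg _) ?_ 2) (by positivity)
      rw [Complex.norm_real, hφd, norm_div, Real.norm_of_nonneg hn'.le]
      exact div_le_div_of_nonneg_right (hC _) hn'.le
    have hfin : 2 * n * A ≤ ‖R‖ ^ 2 * ((C / n) ^ 2 * (2 * (2 * n : ℕ) * A)) :=
      hlow.trans (hb2.trans (mul_le_mul_of_nonneg_left hup (by positivity)))
    have h1 : ‖R‖ ^ 2 * ((C / n) ^ 2 * (2 * (2 * n : ℕ) * A))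
        = 2 * n * A * (2 * (‖R‖ * C) ^ 2) / n ^ 2 := by
      push_cast
      field_simp
    rw [h1, le_div_iff₀ (by positivity)] at hfin
    exact le_of_mul_le_mul_left hfin (by positivity)
  -- The added `1` gives `n > 1`, so `n²` exceeds `n` and the bound in `key` fails.
  obtain ⟨n, hn⟩ := exists_nat_gt (2 * (‖R‖ * C) ^ 2 + 1)
  have hn1 : (1 : ℝ) < n := lt_of_le_of_lt (by nlinarith [sq_nonneg (‖R‖ * C)]) hn
  have := key n (by exact_mod_cast zero_lt_one.trans hn1)
  nlinarith

lemma spectrumOf_operator (hv : IsPotential v) :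
    spectrumOf (operator v) = Set.range (fun t : ℝ => (t : ℂ)) := by
  ext z
  constructor
  · intro hz
    refine ⟨z.re, Complex.ext rfl ?_⟩
    by_contra h
    exact hz (isResolventPoint_of_im_ne_zero hv fun h0 => h (by simp [h0]))
  · rintro ⟨t, rfl⟩
    exact not_isResolventPoint_ofReal hv t

end Manakov

theorem theorem1p1 (v : Fin 2 → ℝ → ℂ) (hv : Manakov.IsPotential v) :
    -- the fundamental solution is well defined
    (∀ z : ℂ, ∃! y, Manakov.IsFundamentalSolution v z y) ∧
    -- asymptotics of the multipliers, suitably labelled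
    (∃ τ : Fin 3 → ℂ → ℂ,
      (∀ z : ℂ, Manakov.multipliers v z = {τ 0 z, τ 1 z, τ 2 z}) ∧
      ∀ δ : ℝ, 0 < δ → δ < 1 / 2 → ∀ j : Fin 3,
        τ j ~[Manakov.awayFilter δ] Manakov.freeMultiplier j) ∧
    -- the characteristic polynomial
    (∀ τ z : ℂ, Manakov.D v τ z =
      -τ ^ 3 + τ ^ 2 * Manakov.T v z
        - τ * Complex.exp (Complex.I * z) * Manakov.Ttilde v z + Complex.exp (Complex.I * z)) ∧
    -- the determinant and the identities for the multipliers, in any labelling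
    (∀ z : ℂ, (Manakov.monodromy v z).det = Complex.exp (Complex.I * z)) ∧
    (∀ z τ₁ τ₂ τ₃ : ℂ, Manakov.multipliers v z = {τ₁, τ₂, τ₃} →
      Complex.exp (Complex.I * z) = τ₁ * τ₂ * τ₃ ∧
      Manakov.Ttilde v z = 1 / τ₁ + 1 / τ₂ + 1 / τ₃ ∧
      Manakov.Ttilde v z =
        Complex.exp (-Complex.I * z) * (τ₁ * τ₂ + τ₂ * τ₃ + τ₃ * τ₁)) ∧
    -- the spectrum
    Manakov.spectrumOf (Manakov.operator v) = Set.range (fun t : ℝ => (t : ℂ)) ∧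
    Manakov.spectralPart v 1 ∪ Manakov.spectralPart v 3 = Set.univ ∧
    Manakov.spectralPart v 2 = ∅ := by
  refine ⟨Manakov.existsUnique_isFundamentalSolution hv, ?_, Manakov.D_eq hv,
    Manakov.det_monodromy hv, fun z τ₁ τ₂ τ₃ h => Manakov.multipliers_identities hv h,
    Manakov.spectrumOf_operator hv, Manakov.spectralPart_one_union_three hv,
    Manakov.spectralPart_two hv⟩
  obtain ⟨τ, h1, h2⟩ := Manakov.exists_labelling_isEquivalent hv
  exact ⟨τ, h1, fun δ hδ _ j => h2 δ hδ j⟩
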